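/- **Theorem.** Consider a completely connected synchronous network of three players $A,B,C$ in which $A$ is the General. No polynomial-time authenticated Byzantine Generals (ABG) protocol with trusted preprocessing remains correct under two parallel self-compositions, even with unique session identifiers, when it has to tolerate the adversary basis $$\bar{\mathcal A}=\{((C),(A));\ ((A),(\emptyset));\ ((B),(A))\},$$ where $((x),(y))$ means that the adversary Byzantine-corrupts $x$ in the first and $y$ in the second of the two parallel executions $E_1,E_2$. Here the notions are as follows. *Protocol.* For each security parameter $k$, a trusted preprocessing phase draws setup tapes (private and public keys) from a joint distribution and gives one to each player. In each execution every player runs a probabilistic polynomial-time process on its setup tape, the session identifier of that execution, fresh random bits, and, for the General, an input $v\in\{0,1\}$. The processes exchange messages of polynomially bounded length over authenticated point-to-point channels for a polynomial number of synchronous rounds and then give an output. The two executions run in parallel with distinct session identifiers; processes of different executions do not interact. *Adversary.* The adversary is probabilistic polynomial-time and coordinates both executions. It determines the messages and outputs of the Byzantine-corrupt processes. If a player is Byzantine-corrupt in at least one execution, the adversary learns this player's setup tape and all messages it receives in both executions; the processes of such a player in an execution where it is not Byzantine-corrupt are *passively corrupt*: they follow the protocol, but the adversary also sees their random bits. The adversary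 chooses the General's inputs. *Correctness.* In the ideal process for a set $I$ of corrupt players, the General sends his value (any value chosen by the ideal adversary if the General is in $I$) to a trusted party, who forwards it to all players and to the ideal adversary; players outside $I$ output this value, and the ideal adversary determines the outputs of the players in $I$. The protocol is correct under two parallel self-compositions tolerating $\bar{\mathcal A}$ if for every element $Z=((Z_1),(Z_2))$ of $\bar{\mathcal A}$, every probabilistic polynomial-time adversary that corrupts according to $Z$, each $l\in\{1,2\}$ and each choice of the General's input in the other execution, there is a probabilistic polynomial-time ideal adversary corrupting $Z_l$ such that, for each input $v\in\{0,1\}$ of the General in $E_l$, the vector of all players' outputs in the ideal process with input $v$ and the vector of all players' outputs in $E_l$ are computationally indistinguishable in $k$. (So passively corrupt players count as honest: they must be consistent with the honest ones.) -/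

import Mathlib

namespace ABG

/-! ## Machines: loop programs on bit strings, with a step count -/

/-- Bit strings. -/
abbrev Str : Type := List Bool

/-- A memory: every register of `ρ` holds a bit string. -/
abbrev Store (ρ : Type) : Type := ρ → Str

/-- Structured programs on string registers. All loops are counted, so all programs halt; the
programs whose step count (see `Prog.run`) is polynomially bounded compute exactly the
polynomial-time functions, because a clocked Turing machine is simulated by nested loops. -/
inductive Prog (ρ : Type) : Type
  | skip : Prog ρ
  /-- put a bit in front of the string in a register -/
  | push (r : ρ) (b : Bool) : Prog ρ
  /-- remove the first bit of the string in a register -/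
  | pop (r : ρ) : Prog ρ
  /-- `copy r r'` overwrites `r'` by the content of `r` -/
  | copy (r r' : ρ) : Prog ρ
  | seq (p q : Prog ρ) : Prog ρ
  /-- branch: the register is empty / starts with `false` / starts with `true` -/
  | branch (r : ρ) (p₀ p₁ p₂ : Prog ρ) : Prog ρ
  /-- repeat `p`, as many times as the string in `r` has bits when the loop is entered -/
  | loop (r : ρ) (p : Prog ρ) : Prog ρ

/-- The final memory and the number of steps. Copying costs the length of the string. -/
def Prog.run {ρ : Type} [DecidableEq ρ] : Prog ρ → Store ρ → Store ρ × ℕ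
  | .skip, s => (s, 1)
  | .push r b, s => (Function.update s r (b :: s r), 1)
  | .pop r, s => (Function.update s r (s r).tail, 1)
  | .copy r r', s => (Function.update s r' (s r), (s r).length + 1)
  | .seq p q, s => ((q.run (p.run s).1).1, (p.run s).2 + (q.run (p.run s).1).2)
  | .branch r p₀ p₁ p₂, s =>
      match s r with
      | [] => ((p₀.run s).1, (p₀.run s).2 + 1)
      | false :: _ => ((p₁.run s).1, (p₁.run s).2 + 1)
      | true :: _ => ((p₂.run s).1, (p₂.run s).2 + 1)
  | .loop r p, s =>
      (fun a : Store ρ × ℕ => ((p.run a.1).1, a.2 + (p.run a.1).2 + 1))^[(s r).length] (s, 1)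

/-- The memory after running `p`. -/
def Prog.eval {ρ : Type} [DecidableEq ρ] (p : Prog ρ) (s : Store ρ) : Store ρ := (p.run s).1

/-- The number of steps that `p` takes from the memory `s`. -/
def Prog.time {ρ : Type} [DecidableEq ρ] (p : Prog ρ) (s : Store ρ) : ℕ := (p.run s).2

/-- The memory of a machine that is activated once per round: in activation `r` the environment
first changes the memory by `write r` (it delivers messages), then the program runs. The memory
persists between activations. -/
def trajectory {ρ : Type} [DecidableEq ρ] (p : Prog ρ) (write : ℕ → Store ρ → Store ρ)
    (s : Store ρ) : ℕ → Store ρ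
  | 0 => s
  | r + 1 => p.eval (write r (trajectory p write s r))

/-- A probabilistic machine: a program, and the number of its uniform random bits as a function of
the security parameter. -/
structure Machine (ρ : Type) where
  prog : Prog ρ
  coinLen : Polynomial ℕ

/-- The security parameter in unary. -/
def unary (k : ℕ) : Str := List.replicate k true

/-! ## Protocols -/

/-- Registers of a process that executes the protocol. -/
inductive PartyReg (P : Type) : Type
  | secParam
  /-- the setup tape of the player: keys from the preprocessing phase -/
  | setup
  /-- the unique session identifier of the execution -/
  | sid
  /-- the input (empty for all players but the General) -/
  | input
  | coins
  /-- the message that just arrived from player `j` -/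
  | inbox (j : P)
  /-- the message to be sent to player `j` -/
  | outbox (j : P)
  | output
  | work (n : ℕ)
  deriving DecidableEq

/-- Memory of a process before the first round. -/
def partyInit {P : Type} (k : ℕ) (setup sid input coins : Str) : Store (PartyReg P)
  | .secParam => unary k
  | .setup => setup
  | .sid => sid
  | .input => input
  | .coins => coins
  | _ => []

/-- Delivery of messages to a process. -/
def partyWrite {P : Type} (inc : P → Str) (s : Store (PartyReg P)) : Store (PartyReg P)
  | .inbox j => inc j
  | r => s r

/-- A synchronous protocol with a trusted preprocessing phase for the players in `P`. All the
lengths are functions of the security parameter. -/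
structure Protocol (P : Type) where
  /-- the code of each player -/
  prog : P → Prog (PartyReg P)
  /-- joint distribution of the setup tapes of the players; it may be arbitrarily correlated, so
  that every tape can hold a private key and the public keys of all the players -/
  setup : ℕ → PMF (P → Str)
  /-- bound on the length of a setup tape -/
  setupLen : Polynomial ℕ
  /-- bound on the length of a session identifier -/
  sidLen : Polynomial ℕ
  /-- number of random bits of a process -/
  coinLen : Polynomial ℕ
  /-- bound on the length of a message; processes do not read messages beyond it -/
  msgLen : Polynomial ℕ
  /-- number of activations, after which the outputs are read -/
  rounds : Polynomial ℕ

/-- The protocol runs in polynomial time, whatever messages the processes receive: the setup tapes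
have the declared lengths, every activation takes polynomially many steps, and the messages sent
respect the declared bound. -/
def Protocol.PolyTime {P : Type} [DecidableEq P] (Q : Protocol P) : Prop :=
  (∀ k, ∀ τ ∈ (Q.setup k).support, ∀ i, (τ i).length ≤ Q.setupLen.eval k) ∧
  ∃ q : Polynomial ℕ, ∀ (k : ℕ) (i : P) (τ sid input coins : Str) (inc : ℕ → P → Str),
    τ.length ≤ Q.setupLen.eval k → sid.length ≤ Q.sidLen.eval k → input.length ≤ 1 →
    coins.length = Q.coinLen.eval k → (∀ r j, (inc r j).length ≤ Q.msgLen.eval k) →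
    ∀ r < Q.rounds.eval k,
      (Q.prog i).time (partyWrite (inc r)
        (trajectory (Q.prog i) (fun r => partyWrite (inc r))
          (partyInit k τ sid input coins) r)) ≤ q.eval k ∧
      ∀ j, (trajectory (Q.prog i) (fun r => partyWrite (inc r))
          (partyInit k τ sid input coins) (r + 1) (.outbox j)).length ≤ Q.msgLen.eval k

/-- `sid k l` is the session identifier of execution `l` for security parameter `k`: identifiers
of different executions differ, and have the length that the protocol allows. -/
def Protocol.UniqueSids {P : Type} (Q : Protocol P) {m : ℕ} (sid : ℕ → Fin m → Str) : Prop :=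
  ∀ k, Function.Injective (sid k) ∧ ∀ l, (sid k l).length ≤ Q.sidLen.eval k

/-! ## The real process: `m` parallel executions -/

/-- Who is Byzantine corrupt in which execution. -/
abbrev Pattern (P : Type) (m : ℕ) : Type := Fin m → Finset P

/-- The player is Byzantine corrupt in some execution. The adversary then reads all the private
data of the player, in all executions; in an execution `l` with `i ∉ Z l` the process of such a
player is passively corrupt: it follows the protocol, but the adversary sees its data. -/
def Pattern.Faulty {P : Type} {m : ℕ} (Z : Pattern P m) (i : P) : Prop := ∃ l, i ∈ Z l

/-- Registers of the adversary, who coordinates all the executions. -/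
inductive AdvReg (P : Type) (m : ℕ) : Type
  | secParam
  | sid (l : Fin m)
  /-- the input of the General in execution `l` -/
  | input (l : Fin m)
  /-- the setup tape of a faulty player -/
  | setup (i : P)
  /-- the random bits of the process of a faulty player -/
  | procCoins (l : Fin m) (i : P)
  /-- the adversary's own random bits -/
  | coins
  /-- the message that just arrived from `j` at the faulty player `i` in execution `l` -/
  | inbox (l : Fin m) (i j : P)
  /-- the message to be sent to `j` by the Byzantine process `i` of execution `l` -/
  | outbox (l : Fin m) (i j : P)
  /-- the output of the Byzantine process `i` of execution `l` -/
  | output (l : Fin m) (i : P)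
  | work (n : ℕ)
  deriving DecidableEq

/-- Memory of the adversary before the first round. -/
def advInit {P : Type} {m : ℕ} (k : ℕ) (sid : Fin m → Str) (x : Fin m → Bool)
    (setup : P → Str) (procCoins : Fin m → P → Str) (coins : Str) : Store (AdvReg P m)
  | .secParam => unary k
  | .sid l => sid l
  | .input l => [x l]
  | .setup i => setup i
  | .procCoins l i => procCoins l i
  | .coins => coins
  | _ => []

/-- Delivery of messages to the adversary. -/
def advWrite {P : Type} {m : ℕ} (inc : Fin m → P → P → Str) (s : Store (AdvReg P m)) :
    Store (AdvReg P m)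
  | .inbox l i j => inc l i j
  | r => s r

/-- A probabilistic polynomial-time real process adversary: whatever (length-bounded) data and
messages it receives, each activation takes polynomially many steps. -/
def AdvPolyTime {P : Type} [DecidableEq P] {m : ℕ} (Q : Protocol P) (M : Machine (AdvReg P m)) :
    Prop :=
  ∃ q : Polynomial ℕ, ∀ (k : ℕ) (sid : Fin m → Str) (x : Fin m → Bool) (τ : P → Str)
    (procCoins : Fin m → P → Str) (coins : Str) (inc : ℕ → Fin m → P → P → Str),
    (∀ l, (sid l).length ≤ Q.sidLen.eval k) → (∀ i, (τ i).length ≤ Q.setupLen.eval k) →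
    (∀ l i, (procCoins l i).length ≤ Q.coinLen.eval k) → coins.length = M.coinLen.eval k →
    (∀ r l i j, (inc r l i j).length ≤ Q.msgLen.eval k) →
    ∀ r < Q.rounds.eval k,
      M.prog.time (advWrite (inc r) (trajectory M.prog (fun r => advWrite (inc r))
        (advInit k sid x τ procCoins coins) r)) ≤ q.eval k

/-- A global state of `m` parallel executions. (The stores `proc l i` of Byzantine processes are
kept for uniformity, but nothing depends on them.) -/
structure Global (P : Type) (m : ℕ) where
  proc : Fin m → P → Store (PartyReg P)
  adv : Store (AdvReg P m)

/-- The message that `i` sends to `j` in execution `l`: Byzantine processes are controlled by the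
adversary, all others follow the protocol. -/
def Global.msg {P : Type} [DecidableEq P] {m : ℕ} (Z : Pattern P m) (len : ℕ) (G : Global P m)
    (l : Fin m) (i j : P) : Str :=
  (if i ∈ Z l then G.adv (.outbox l i j) else G.proc l i (.outbox j)).take len

open Classical in
/-- One synchronous round, in all executions: the messages sent are delivered, then everybody
computes. A process only sees messages of its own execution. The adversary sees the messages that
arrive at faulty players, in every execution. -/
noncomputable def Global.step {P : Type} [DecidableEq P] {m : ℕ} (Q : Protocol P) (Z : Pattern P m)
    (M : Machine (AdvReg P m)) (len : ℕ) (G : Global P m) : Global P m where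
  proc l j := (Q.prog j).eval (partyWrite (fun i => G.msg Z len l i j) (G.proc l j))
  adv := M.prog.eval
    (advWrite (fun l i j => if Z.Faulty i then G.msg Z len l j i else []) G.adv)

open Classical in
/-- The state before the first round. The General `g` has input `x l` in execution `l`. The setup
tapes `τ` are the same in all executions, and the random bits `c` are separate. -/
noncomputable def Global.init {P : Type} [DecidableEq P] {m : ℕ} (g : P) (Z : Pattern P m) (k : ℕ)
    (sid : Fin m → Str) (x : Fin m → Bool) (τ : P → Str) (c : Fin m → P → Str) (a : Str) :
    Global P m where
  proc l i := partyInit k (τ i) (sid l) (if i = g then [x l] else []) (c l i)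
  adv := advInit k sid x (fun i => if Z.Faulty i then τ i else [])
    (fun l i => if Z.Faulty i ∧ i ∉ Z l then c l i else []) a

/-- The outputs of all players in execution `l`; the adversary determines those of the Byzantine
processes. -/
def Global.outputs {P : Type} [DecidableEq P] {m : ℕ} (Z : Pattern P m) (G : Global P m)
    (l : Fin m) (i : P) : Str :=
  if i ∈ Z l then G.adv (.output l i) else G.proc l i .output

/-- The distribution of the output vector of execution `l`, when the protocol `Q` is run in `m`
parallel executions in the presence of the adversary `M`. -/
noncomputable def real {P : Type} [DecidableEq P] [Fintype P] {m : ℕ} (Q : Protocol P) (g : P)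
    (Z : Pattern P m) (M : Machine (AdvReg P m)) (sid : ℕ → Fin m → Str) (x : Fin m → Bool)
    (l : Fin m) (k : ℕ) : PMF (P → Str) :=
  (Q.setup k).bind fun τ =>
  (PMF.uniformOfFintype (Fin m → P → Fin (Q.coinLen.eval k) → Bool)).bind fun c =>
  (PMF.uniformOfFintype (Fin (M.coinLen.eval k) → Bool)).map fun a =>
    ((Global.step Q Z M (Q.msgLen.eval k))^[Q.rounds.eval k]
      (Global.init g Z k (sid k) x τ (fun l i => List.ofFn (c l i)) (List.ofFn a))).outputs Z l

/-! ## The ideal process -/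

/-- Registers of the ideal process adversary. -/
inductive IdealReg (P : Type) (m : ℕ) : Type
  | secParam
  | sid (l : Fin m)
  /-- the General's value: his input if he is corrupt, else what the trusted party forwards -/
  | value
  | coins
  /-- the value that a corrupt General sends to the trusted party -/
  | toTTP
  /-- the output of the corrupt player `i` -/
  | output (i : P)
  | work (n : ℕ)
  deriving DecidableEq

/-- Memory of the ideal process adversary at the start. -/
def idealInit {P : Type} {m : ℕ} (k : ℕ) (sid : Fin m → Str) (v : Bool) (coins : Str) :
    Store (IdealReg P m)
  | .secParam => unary k
  | .sid l => sid l
  | .value => [v]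
  | .coins => coins
  | _ => []

/-- A probabilistic polynomial-time ideal process adversary. -/
def IdealPolyTime {P : Type} [DecidableEq P] {m : ℕ} (S : Machine (IdealReg P m)) : Prop :=
  ∃ q : Polynomial ℕ, ∀ (k : ℕ) (sid : Fin m → Str) (v : Bool) (coins : Str),
    coins.length = S.coinLen.eval k →
    S.prog.time (idealInit k sid v coins) ≤ q.eval (k + ∑ l, (sid l).length)

/-- The output vector in the ideal process, given the final memory of the ideal adversary, when the
players in `I` are corrupt: all players outside `I` output the value that the trusted party got. -/
def idealOutputs {P : Type} [DecidableEq P] {m : ℕ} (g : P) (I : Finset P) (v : Bool)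
    (s : Store (IdealReg P m)) (i : P) : Str :=
  if i ∈ I then s (.output i) else if g ∈ I then s .toTTP else [v]

/-- The distribution of the output vector in the ideal process. -/
noncomputable def ideal {P : Type} [DecidableEq P] {m : ℕ} (g : P) (I : Finset P)
    (S : Machine (IdealReg P m)) (sid : ℕ → Fin m → Str) (v : Bool) (k : ℕ) : PMF (P → Str) :=
  (PMF.uniformOfFintype (Fin (S.coinLen.eval k) → Bool)).map fun c =>
    idealOutputs g I v (S.prog.eval (idealInit k (sid k) v (List.ofFn c)))

/-! ## Computational indistinguishability -/

/-- Registers of a distinguisher. -/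
inductive DistReg (P : Type) : Type
  | secParam
  /-- the output of player `i` in the given output vector -/
  | sample (i : P)
  | coins
  | verdict
  | work (n : ℕ)
  deriving DecidableEq

/-- Memory of a distinguisher at the start. -/
def distInit {P : Type} (k : ℕ) (o : P → Str) (coins : Str) : Store (DistReg P)
  | .secParam => unary k
  | .sample i => o i
  | .coins => coins
  | _ => []

/-- A probabilistic polynomial-time distinguisher. -/
def DistPolyTime {P : Type} [DecidableEq P] [Fintype P] (D : Machine (DistReg P)) : Prop :=
  ∃ q : Polynomial ℕ, ∀ (k : ℕ) (o : P → Str) (coins : Str), coins.length = D.coinLen.eval k →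
    D.prog.time (distInit k o coins) ≤ q.eval (k + ∑ i, (o i).length)

/-- The probability that `D` answers `1` on a sample of `X`. -/
noncomputable def acceptProb {P : Type} [DecidableEq P] (D : Machine (DistReg P)) (k : ℕ)
    (X : PMF (P → Str)) : ℝ :=
  ((X.bind fun o => (PMF.uniformOfFintype (Fin (D.coinLen.eval k) → Bool)).map fun c =>
    decide (D.prog.eval (distInit k o (List.ofFn c)) .verdict = [true])) true).toReal

/-- Every probabilistic polynomial-time distinguisher has negligible advantage. -/
def CompIndist {P : Type} [DecidableEq P] [Fintype P] (X Y : ℕ → PMF (P → Str)) : Prop :=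
  ∀ D : Machine (DistReg P), DistPolyTime D →
    Asymptotics.SuperpolynomialDecay Filter.atTop (fun k : ℕ => (k : ℝ))
      (fun k => |acceptProb D k (X k) - acceptProb D k (Y k)|)

/-! ## Composable Authenticated Byzantine Generals -/

/-- `Q`, with General `g` and session identifiers `sid`, satisfies the requirements of
Authenticated Byzantine Generals in each of `m` parallel executions, against every adversary whose
corruptions are listed in `B`: for every polynomial-time adversary, every execution `l` and every
choice `x` of the inputs of the other executions, there is a polynomial-time ideal adversary that
corrupts the players in `Z l` such that, for both inputs `v` of execution `l`, the output vector of
the ideal process and that of execution `l` are computationally indistinguishable. The players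
outside `Z l`, including the passively corrupt ones, count as honest in execution `l`. -/
def Protocol.ParallelABG {P : Type} [DecidableEq P] [Fintype P] {m : ℕ} (Q : Protocol P) (g : P)
    (sid : ℕ → Fin m → Str) (B : Set (Pattern P m)) : Prop :=
  ∀ Z ∈ B, ∀ M : Machine (AdvReg P m), AdvPolyTime Q M → ∀ (l : Fin m) (x : Fin m → Bool),
    ∃ S : Machine (IdealReg P m), IdealPolyTime S ∧ ∀ v : Bool,
      CompIndist (ideal g (Z l) S sid v) (real Q g Z M sid (Function.update x l v) l)

/-- The three players. -/
inductive Player : Type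
  | A
  | B
  | C
  deriving DecidableEq

instance : Fintype Player where
  elems := {.A, .B, .C}
  complete i := by cases i <;> decide

/-- The adversary basis `{((C),(A)); ((A),(∅)); ((B),(A))}`. -/
def basis : Set (Pattern Player 2) :=
  {![{.C}, {.A}], ![{.A}, ∅], ![{.B}, {.A}]}

end ABG

/-! Unfold the triangle of players into a path `a₀ - b - c - a₁`, whose ends are two copies of `A`
with inputs 0 and 1 but the same setup tape and session identifier. This system never occurs in a
real run, yet each pair of neighbours on it can be placed in execution `0` with an admissible
adversary simulating the rest. With corruptions ((C),(A)) the adversary simulates `c` and `a₁`; the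
honest pair is `a₀`, `b`, so `b` must output 0. With ((B),(A)) it simulates `b` and `a₀`, so `c`
must output 1. With ((A),(∅)) it simulates both ends, so `b` and `c` must agree. Each requirement
holds on the path with probability tending to 1, which contradicts P(b = 0) + P(c = 1) ≤ 1 + P(b = 0
and c = 1).

Neither authentication nor unique identifiers prevent the first two attacks. Corrupting `A` in
execution `1` reveals the setup tape of `A`, and with it a second copy of `A` can be run under the
identifier of execution `0`. Nothing has to happen in execution `1` itself, and the adversary sends
no messages there.

The core is that the three attacks produce marginals of one and the same distribution `pathOutputs`.
`Attack.proc_eq_fullRun` shows that honest processes evolve exactly as on the path,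
`Attack.map_assign` that the random bits of the path are uniform, and `Attack.real_map` combines the
two. `Attack.advPolyTime` makes the adversary admissible, and `Attack.tendsto` transfers correctness
to the path. -/

namespace ABG

/-! ### Evaluation, cost and renaming of programs -/

section Programs

variable {ρ σ : Type} [DecidableEq ρ] [DecidableEq σ]

@[simp] theorem Prog.eval_skip (s : Store ρ) : (Prog.skip : Prog ρ).eval s = s := rfl

@[simp] theorem Prog.eval_push (r : ρ) (b : Bool) (s : Store ρ) :
    (Prog.push r b).eval s = Function.update s r (b :: s r) := rfl

@[simp] theorem Prog.eval_pop (r : ρ) (s : Store ρ) :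
    (Prog.pop r).eval s = Function.update s r (s r).tail := rfl

@[simp] theorem Prog.eval_copy (r r' : ρ) (s : Store ρ) :
    (Prog.copy r r').eval s = Function.update s r' (s r) := rfl

@[simp] theorem Prog.eval_seq (p q : Prog ρ) (s : Store ρ) :
    (Prog.seq p q).eval s = q.eval (p.eval s) := rfl

@[simp] theorem Prog.time_skip (s : Store ρ) : (Prog.skip : Prog ρ).time s = 1 := rfl

@[simp] theorem Prog.time_push (r : ρ) (b : Bool) (s : Store ρ) :
    (Prog.push r b).time s = 1 := rfl

@[simp] theorem Prog.time_pop (r : ρ) (s : Store ρ) : (Prog.pop r).time s = 1 := rfl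

@[simp] theorem Prog.time_copy (r r' : ρ) (s : Store ρ) :
    (Prog.copy r r').time s = (s r).length + 1 := rfl

@[simp] theorem Prog.time_seq (p q : Prog ρ) (s : Store ρ) :
    (Prog.seq p q).time s = p.time s + q.time (p.eval s) := rfl

theorem Prog.eval_branch (r : ρ) (p₀ p₁ p₂ : Prog ρ) (s : Store ρ) :
    (Prog.branch r p₀ p₁ p₂).eval s =
      match s r with
      | [] => p₀.eval s
      | false :: _ => p₁.eval s
      | true :: _ => p₂.eval s := by
  simp only [Prog.eval, Prog.run]
  rcases s r with _ | ⟨_ | _, _⟩ <;> rfl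

theorem Prog.time_branch (r : ρ) (p₀ p₁ p₂ : Prog ρ) (s : Store ρ) :
    (Prog.branch r p₀ p₁ p₂).time s =
      match s r with
      | [] => p₀.time s + 1
      | false :: _ => p₁.time s + 1
      | true :: _ => p₂.time s + 1 := by
  simp only [Prog.time, Prog.run]
  rcases s r with _ | ⟨_ | _, _⟩ <;> rfl

/-- The number of passes is fixed on entry, so a loop is a plain iterate of its body and its cost is
a sum along the orbit. -/
theorem Prog.loop_aux (p : Prog ρ) (s : Store ρ) (n : ℕ) :
    ((fun a : Store ρ × ℕ => ((p.run a.1).1, a.2 + (p.run a.1).2 + 1))^[n] (s, 1)) =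
      (p.eval^[n] s, 1 + ∑ i ∈ Finset.range n, (p.time (p.eval^[i] s) + 1)) := by
  induction n with
  | zero => rfl
  | succ n ih =>
    rw [Function.iterate_succ_apply', ih, Function.iterate_succ_apply', Finset.sum_range_succ]
    simp only [Prog.eval, Prog.time]
    ext1
    · rfl
    · simp only; omega

theorem Prog.eval_loop (r : ρ) (p : Prog ρ) (s : Store ρ) :
    (Prog.loop r p).eval s = p.eval^[(s r).length] s :=
  congrArg Prod.fst (Prog.loop_aux p s _)

theorem Prog.time_loop (r : ρ) (p : Prog ρ) (s : Store ρ) :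
    (Prog.loop r p).time s =
      1 + ∑ i ∈ Finset.range (s r).length, (p.time (p.eval^[i] s) + 1) :=
  congrArg Prod.snd (Prog.loop_aux p s _)

theorem Prog.time_loop_le {p : Prog ρ} {b : ℕ} (h : ∀ s, p.time s ≤ b) (r : ρ) (s : Store ρ) :
    (Prog.loop r p).time s ≤ 1 + (s r).length * (b + 1) := by
  rw [Prog.time_loop]
  gcongr
  refine (Finset.sum_le_card_nsmul _ _ (b + 1) fun i _ => ?_).trans (by simp)
  have := h (p.eval^[i] s)
  omega

/-- The same program on renamed registers. -/
def Prog.map (f : ρ → σ) : Prog ρ → Prog σ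
  | .skip => .skip
  | .push r b => .push (f r) b
  | .pop r => .pop (f r)
  | .copy r r' => .copy (f r) (f r')
  | .seq p q => .seq (p.map f) (q.map f)
  | .branch r p₀ p₁ p₂ => .branch (f r) (p₀.map f) (p₁.map f) (p₂.map f)
  | .loop r p => .loop (f r) (p.map f)

theorem update_comp_of_injective {f : ρ → σ} (hf : Function.Injective f) (s : Store σ) (r : ρ)
    (x : Str) : Function.update s (f r) x ∘ f = Function.update (s ∘ f) r x :=
  Function.update_comp_eq_of_injective s hf r x

/-- Injectivity keeps renamed registers from colliding, so the run is the original one with the same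
step count. The last clause lets several simulated processes live side by side in one memory. -/
theorem Prog.map_spec {f : ρ → σ} (hf : Function.Injective f) (p : Prog ρ) :
    ∀ s : Store σ, (p.map f).eval s ∘ f = p.eval (s ∘ f) ∧ (p.map f).time s = p.time (s ∘ f) ∧
      ∀ t, t ∉ Set.range f → (p.map f).eval s t = s t := by
  have upd : ∀ (s : Store σ) (r : ρ) (x : Str) (t : σ), t ∉ Set.range f →
      Function.update s (f r) x t = s t := fun s r x t ht =>
    Function.update_of_ne (fun h => ht ⟨r, h.symm⟩) _ _
  induction p with
  | skip => intro s; simp [Prog.map]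
  | push r b =>
    intro s
    exact ⟨update_comp_of_injective hf s r _, rfl, upd s r _⟩
  | pop r =>
    intro s
    exact ⟨update_comp_of_injective hf s r _, rfl, upd s r _⟩
  | copy r r' =>
    intro s
    exact ⟨update_comp_of_injective hf s r' _, rfl, upd s r' _⟩
  | seq p q ihp ihq =>
    intro s
    obtain ⟨h₁, h₂, h₃⟩ := ihp s
    obtain ⟨k₁, k₂, k₃⟩ := ihq ((p.map f).eval s)
    refine ⟨?_, ?_, fun t ht => ?_⟩
    · simp only [Prog.map, Prog.eval_seq, k₁, h₁]
    · simp only [Prog.map, Prog.time_seq, h₂, k₂, h₁]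
    · simp only [Prog.map, Prog.eval_seq, k₃ t ht, h₃ t ht]
  | branch r p₀ p₁ p₂ ih₀ ih₁ ih₂ =>
    intro s
    simp only [Prog.map, Prog.eval_branch, Prog.time_branch, Function.comp_apply]
    rcases s (f r) with _ | ⟨_ | _, _⟩
    · exact ⟨(ih₀ s).1, by simp [(ih₀ s).2.1], (ih₀ s).2.2⟩
    · exact ⟨(ih₁ s).1, by simp [(ih₁ s).2.1], (ih₁ s).2.2⟩
    · exact ⟨(ih₂ s).1, by simp [(ih₂ s).2.1], (ih₂ s).2.2⟩
  | loop r p ih =>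
    intro s
    have key : ∀ n, ((p.map f).eval^[n] s) ∘ f = p.eval^[n] (s ∘ f) ∧
        ∀ t, t ∉ Set.range f → (p.map f).eval^[n] s t = s t := by
      intro n
      induction n with
      | zero => simp
      | succ n ihn =>
        simp only [Function.iterate_succ_apply']
        refine ⟨by rw [(ih _).1, ihn.1], fun t ht => ?_⟩
        rw [(ih _).2.2 t ht, ihn.2 t ht]
    simp only [Prog.map, Prog.eval_loop, Prog.time_loop, Function.comp_apply]
    refine ⟨(key _).1, ?_, (key _).2⟩
    congr 1
    exact Finset.sum_congr rfl fun i _ => by rw [(ih _).2.1, (key i).1]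

theorem Prog.eval_map {f : ρ → σ} (hf : Function.Injective f) (p : Prog ρ) (s : Store σ) :
    (p.map f).eval s ∘ f = p.eval (s ∘ f) := (p.map_spec hf s).1

theorem Prog.time_map {f : ρ → σ} (hf : Function.Injective f) (p : Prog ρ) (s : Store σ) :
    (p.map f).time s = p.time (s ∘ f) := (p.map_spec hf s).2.1

theorem Prog.eval_map_of_notMem {f : ρ → σ} (hf : Function.Injective f) (p : Prog ρ) (s : Store σ)
    {t : σ} (ht : t ∉ Set.range f) : (p.map f).eval s t = s t := (p.map_spec hf s).2.2 t ht

/-- Copy registers, one after the other, along a list of pairs (source, target). -/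
def Prog.copies : List (ρ × ρ) → Prog ρ
  | [] => .skip
  | a :: l => .seq (.copy a.1 a.2) (Prog.copies l)

theorem Prog.eval_copies_of_notMem (l : List (ρ × ρ)) (s : Store ρ) {t : ρ}
    (ht : ∀ a ∈ l, a.2 ≠ t) : (Prog.copies l).eval s t = s t := by
  induction l generalizing s with
  | nil => rfl
  | cons a l ih =>
    rw [Prog.copies, Prog.eval_seq, ih _ fun b hb => ht b (List.mem_cons_of_mem _ hb),
      Prog.eval_copy, Function.update_of_ne (ht a List.mem_cons_self).symm]

/-- No source is ever overwritten, so the sequential copies act as one simultaneous assignment. A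
target may recur, but only with the same source. -/
theorem Prog.eval_copies_of_mem (l : List (ρ × ρ)) (s : Store ρ)
    (h₁ : ∀ a ∈ l, ∀ b ∈ l, a.1 ≠ b.2) (h₂ : ∀ a ∈ l, ∀ b ∈ l, a.2 = b.2 → a.1 = b.1)
    {a : ρ × ρ} (ha : a ∈ l) : (Prog.copies l).eval s a.2 = s a.1 := by
  induction l generalizing s a with
  | nil => simp at ha
  | cons c l ih =>
    rw [Prog.copies, Prog.eval_seq, Prog.eval_copy]
    by_cases h : ∃ b ∈ l, b.2 = a.2
    · obtain ⟨b, hb, hba⟩ := h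
      have hb' := List.mem_cons_of_mem c hb
      rw [← hba, ih _ (fun x hx y hy => h₁ x (List.mem_cons_of_mem c hx) y
        (List.mem_cons_of_mem c hy)) (fun x hx y hy => h₂ x (List.mem_cons_of_mem c hx) y
        (List.mem_cons_of_mem c hy)) hb, Function.update_of_ne (h₁ b hb' c List.mem_cons_self),
        h₂ b hb' a ha hba]
    · push Not at h
      rw [Prog.eval_copies_of_notMem l _ h]
      rcases List.mem_cons.1 ha with rfl | ha'
      · rw [Function.update_self]
      · exact absurd rfl (h a ha')

theorem Prog.time_copies_le (l : List (ρ × ρ)) (s : Store ρ) {b : ℕ}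
    (h₁ : ∀ a ∈ l, ∀ b ∈ l, a.1 ≠ b.2) (hb : ∀ a ∈ l, (s a.1).length ≤ b) :
    (Prog.copies l).time s ≤ l.length * (b + 1) + 1 := by
  induction l generalizing s with
  | nil => simp [Prog.copies]
  | cons c l ih =>
    have hc := hb c List.mem_cons_self
    have := ih (Function.update s c.2 (s c.1))
      (fun x hx y hy => h₁ x (List.mem_cons_of_mem c hx) y (List.mem_cons_of_mem c hy))
      (fun a ha => by
        rw [Function.update_of_ne (h₁ a (List.mem_cons_of_mem c ha) c List.mem_cons_self)]
        exact hb a (List.mem_cons_of_mem c ha))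
    simp only [Prog.copies, Prog.time_seq, Prog.time_copy, Prog.eval_copy, List.length_cons]
    rw [Nat.add_mul]
    omega

/-- Move `n` bits from a string in front of another one; missing bits are replaced by `false`. -/
def transfer : ℕ → Str → Str → Str
  | 0, _, d => d
  | n + 1, x, d => transfer n x.tail (x.headD false :: d)

theorem length_transfer (n : ℕ) (x d : Str) : (transfer n x d).length = n + d.length := by
  induction n generalizing x d with
  | zero => simp [transfer]
  | succ n ih => simp [transfer, ih]; omega

theorem transfer_eq_reverse (x d : Str) : transfer x.length x d = x.reverse ++ d := by
  induction x generalizing d with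
  | nil => rfl
  | cons b x ih => simp [transfer, ih]

/-- Move as many bits as the register `clock` has. -/
def Prog.transfer (clock src dst : ρ) : Prog ρ :=
  .loop clock (.branch src (.push dst false) (.seq (.pop src) (.push dst false))
    (.seq (.pop src) (.push dst true)))

theorem Prog.eval_transfer_of_ne (clock src dst : ρ) (s : Store ρ) {t : ρ} (h₁ : t ≠ src)
    (h₂ : t ≠ dst) : (Prog.transfer clock src dst).eval s t = s t := by
  rw [Prog.transfer, Prog.eval_loop]
  induction (s clock).length with
  | zero => rfl
  | succ n ih =>
    rw [Function.iterate_succ_apply', ← ih, Prog.eval_branch]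
    split <;> simp [Function.update_of_ne, h₁, h₂]

theorem Prog.eval_transfer (clock : ρ) {src dst : ρ} (h : src ≠ dst) (s : Store ρ) :
    (Prog.transfer clock src dst).eval s dst =
      ABG.transfer (s clock).length (s src) (s dst) := by
  rw [Prog.transfer, Prog.eval_loop]
  induction (s clock).length generalizing s with
  | zero => rfl
  | succ n ih =>
    rw [Function.iterate_succ_apply, ih, Prog.eval_branch, ABG.transfer]
    rcases hs : s src with _ | ⟨_ | _, l⟩ <;> simp [Function.update_of_ne, h, h.symm, hs]

theorem Prog.time_transfer_le (clock src dst : ρ) (s : Store ρ) :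
    (Prog.transfer clock src dst).time s ≤ 1 + (s clock).length * 4 := by
  refine Prog.time_loop_le (fun s => ?_) _ _
  rw [Prog.time_branch]
  split <;> simp

end Programs

/-! ## A path of four processes -/

/-- The processes of the path: two copies of `A`, one with each input, at the ends, and `B` and `C`
between them. -/
inductive Node : Type
  | a₀
  | b
  | c
  | a₁
  deriving DecidableEq

instance : Fintype Node where
  elems := {.a₀, .b, .c, .a₁}
  complete i := by cases i <;> decide

/-- The player whose code the process runs. -/
def Node.player : Node → Player
  | .a₀ => .A
  | .b => .B
  | .c => .C
  | .a₁ => .A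

def Node.input : Node → Str
  | .a₀ => [false]
  | .b => []
  | .c => []
  | .a₁ => [true]

/-- The process that plays the role of player `j` for the given process, if any. -/
def Node.peer : Node → Player → Option Node
  | .a₀, .A => some .a₀
  | .a₀, .B => some .b
  | .a₀, .C => none
  | .b, .A => some .a₀
  | .b, .B => some .b
  | .b, .C => some .c
  | .c, .A => some .a₁
  | .c, .B => some .b
  | .c, .C => some .c
  | .a₁, .A => some .a₁
  | .a₁, .B => none
  | .a₁, .C => some .c

theorem Node.player_of_peer : ∀ {m n : Node} {j : Player}, m.peer j = some n → n.player = j := by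
  decide

theorem Node.peer_symm : ∀ {m n : Node} {j : Player},
    m.peer j = some n → n.peer m.player = some m := by
  decide

theorem Node.length_input_le (n : Node) : n.input.length ≤ 1 := by cases n <;> simp [Node.input]

/-- The messages that reach process `n` when the processes in `S` have the memories `G`, and `ext`
gives the messages that come from outside. -/
def incoming (S : Finset Node) (len : ℕ) (ext : Player → Player → Str)
    (G : Node → Store (PartyReg Player)) (n : Node) (j : Player) : Str :=
  match n.peer j with
  | none => []
  | some m => if m ∈ S then (G m (.outbox n.player)).take len else ext n.player j

/-- The joint run of the processes in `S`, where `ext` gives the messages that come from outside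
in each round. -/
def pathRun (Q : Protocol Player) (S : Finset Node) (len : ℕ) (ext : ℕ → Player → Player → Str)
    (G : Node → Store (PartyReg Player)) : ℕ → Node → Store (PartyReg Player)
  | 0 => G
  | r + 1 => fun n => (Q.prog n.player).eval
      (partyWrite (incoming S len (ext r) (pathRun Q S len ext G r) n)
        (pathRun Q S len ext G r n))

/-- Seen alone, a process of the joint run is a machine fed with some sequence of messages. This is
the form to which the protocol's time bound for single processes applies. -/
theorem pathRun_eq_trajectory (Q : Protocol Player) (S : Finset Node) (len : ℕ)
    (ext : ℕ → Player → Player → Str) (G : Node → Store (PartyReg Player)) (r : ℕ) (n : Node) :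
    pathRun Q S len ext G r n = trajectory (Q.prog n.player)
      (fun r => partyWrite (incoming S len (ext r) (pathRun Q S len ext G r) n)) (G n) r := by
  induction r with
  | zero => rfl
  | succ r ih => rw [pathRun, trajectory, ← ih]

theorem length_incoming_le {S : Finset Node} {len : ℕ} {ext : Player → Player → Str}
    (h : ∀ i j, (ext i j).length ≤ len) (G : Node → Store (PartyReg Player)) (n : Node)
    (j : Player) : (incoming S len ext G n j).length ≤ len := by
  unfold incoming
  split
  · simp
  · split_ifs
    · exact List.length_take_le _ _
    · exact h _ _

/-- Memories of the processes before the first round. -/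
def pathInit (k : ℕ) (τ : Player → Str) (sid : Str) (coins : Node → Str) (n : Node) :
    Store (PartyReg Player) :=
  partyInit k (τ n.player) sid n.input (coins n)

/-! ### Embedding the memories of processes into the adversary's work registers -/

section Registers

def Player.code : Player → ℕ
  | .A => 0
  | .B => 1
  | .C => 2

theorem Player.code_lt (i : Player) : i.code < 3 := by cases i <;> decide

theorem Player.code_injective : Function.Injective Player.code := by
  intro i j; revert i j; decide

def Node.code : Node → ℕ
  | .a₀ => 0
  | .b => 1
  | .c => 2
  | .a₁ => 3

theorem Node.code_lt (n : Node) : n.code < 4 := by cases n <;> decide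

theorem Node.code_injective : Function.Injective Node.code := by
  intro i j; revert i j; decide

/-- The numbering has no gaps, so the four nodes together occupy every `work` register of the
adversary. Flags and scratch space therefore go to the output registers of execution `1`, which do
not affect execution `0`. -/
def PartyReg.code : PartyReg Player → ℕ
  | .secParam => 0
  | .setup => 1
  | .sid => 2
  | .input => 3
  | .coins => 4
  | .output => 5
  | .inbox j => 6 + j.code
  | .outbox j => 9 + j.code
  | .work n => 12 + n

theorem PartyReg.code_injective : Function.Injective PartyReg.code := by
  intro r s h
  cases r with
  | inbox i =>
    cases s with
    | inbox j =>
      simp only [PartyReg.code] at h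
      rw [Player.code_injective (by omega : i.code = j.code)]
    | _ => simp only [PartyReg.code] at h; have := i.code_lt; omega
  | outbox i =>
    cases s with
    | outbox j =>
      simp only [PartyReg.code] at h
      rw [Player.code_injective (by omega : i.code = j.code)]
    | inbox j => simp only [PartyReg.code] at h; have := j.code_lt; omega
    | _ => simp only [PartyReg.code] at h; have := i.code_lt; omega
  | _ =>
    cases s with
    | inbox j => simp only [PartyReg.code] at h; have := j.code_lt; omega
    | outbox j => simp only [PartyReg.code] at h; have := j.code_lt; omega
    | _ => simp only [PartyReg.code] at h ⊢ <;> first | omega | (congr 1; omega)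

/-- Where the adversary keeps the register `r` of the process `n`. -/
def simReg (n : Node) (r : PartyReg Player) : AdvReg Player 2 := .work (4 * r.code + n.code)

@[simp] theorem simReg_inj {n m : Node} {r s : PartyReg Player} :
    simReg n r = simReg m s ↔ n = m ∧ r = s := by
  refine ⟨fun h => ?_, fun h => by rw [h.1, h.2]⟩
  simp only [simReg, AdvReg.work.injEq] at h
  have h₁ := n.code_lt
  have h₂ := m.code_lt
  exact ⟨Node.code_injective (by omega), PartyReg.code_injective (by omega)⟩

theorem simReg_injective (n : Node) : Function.Injective (simReg n) := fun _ _ h =>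
  (simReg_inj.1 h).2

theorem simReg_notMem_range {n m : Node} (h : n ≠ m) (r : PartyReg Player) :
    simReg n r ∉ Set.range (simReg m) := by
  rintro ⟨s, hs⟩
  exact h (simReg_inj.1 hs).1.symm

end Registers

/-! ## The adversary -/

/-- An attack on execution `0`: the adversary simulates two processes of the path, and the two
other ones are processes that follow the protocol. -/
structure Attack where
  pattern : Pattern Player 2
  first : Node
  second : Node
  ne : first ≠ second
  -- The adversary must know the setup tape of every process it simulates; corruption in either
  -- execution suffices.
  faulty : ∀ n ∈ ({first, second} : Finset Node), ∃ l, n.player ∈ pattern l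
  -- Together with `faulty`, this makes the process of this player in execution `1` passively
  -- corrupt, so its random bits are visible and can be borrowed.
  first_notMem : first.player ∉ pattern 1
  honest : ∀ m ∉ ({first, second} : Finset Node), m.player ∉ pattern 0
  player_inj : ∀ m ∉ ({first, second} : Finset Node), ∀ n ∉ ({first, second} : Finset Node),
    m.player = n.player → m = n
  -- Whenever an honest process hears a simulated one, the adversary must be entitled to speak for
  -- that player in execution `0`.
  peer_sim : ∀ m ∉ ({first, second} : Finset Node), ∀ n ∈ ({first, second} : Finset Node),
    ∀ j, m.peer j = some n → j ∈ pattern 0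
  peer_none : ∀ m ∉ ({first, second} : Finset Node), ∀ j, m.peer j = none → j ∈ pattern 0

/-- The simulated processes. -/
def Attack.sim (T : Attack) : Finset Node := {T.first, T.second}

theorem Attack.first_mem (T : Attack) : T.first ∈ T.sim := by simp [Attack.sim]

theorem Attack.second_mem (T : Attack) : T.second ∈ T.sim := by simp [Attack.sim]

theorem Attack.mem_sim (T : Attack) {n : Node} : n ∈ T.sim ↔ n = T.first ∨ n = T.second := by
  simp [Attack.sim]

/-- The register that holds the message of player `j` for the simulated process `n`. -/
def Attack.source (T : Attack) (n : Node) (j : Player) : AdvReg Player 2 :=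
  match n.peer j with
  -- This register stays empty throughout, as does a channel without a partner on the path.
  | none => .output 1 .B
  | some m => if m ∈ T.sim then simReg m (.outbox n.player) else .inbox 0 n.player j

theorem Attack.source_ne (T : Attack) (n m : Node) (i j : Player) :
    T.source n j ≠ simReg m (.inbox i) := by
  unfold Attack.source
  split
  · simp [simReg]
  · split_ifs
    · simp
    · simp [simReg]

/-- The simulated process `n` sends messages to the player `j` of execution `0`. -/
def Attack.Sends (T : Attack) (n : Node) (j : Player) : Prop :=
  n ∈ T.sim ∧ ∃ m, n.peer j = some m ∧ m ∉ T.sim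

instance (T : Attack) (n : Node) (j : Player) : Decidable (T.Sends n j) := by
  unfold Attack.Sends; infer_instance

/-- When both ends are simulated, both write to outboxes of `A`. They do not clash, since an honest
process has only one neighbour in the role of a given player. -/
theorem Attack.Sends.inj {T : Attack} {n n' : Node} {j : Player} (h : T.Sends n j)
    (h' : T.Sends n' j) (hp : n.player = n'.player) : n = n' := by
  obtain ⟨-, m, hm, hms⟩ := h
  obtain ⟨-, m', hm', hms'⟩ := h'
  have : m = m' := T.player_inj m hms m' hms'
    ((Node.player_of_peer hm).trans (Node.player_of_peer hm').symm)
  subst this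
  have h₁ := Node.peer_symm hm
  have h₂ := Node.peer_symm hm'
  rw [hp, h₂] at h₁
  exact (Option.some.inj h₁).symm

def Player.list : List Player := [.A, .B, .C]

theorem Player.mem_list (j : Player) : j ∈ Player.list := by cases j <;> decide

def Attack.deliverList (T : Attack) : List (AdvReg Player 2 × AdvReg Player 2) :=
  [T.first, T.second].flatMap fun n => Player.list.map fun j =>
    (T.source n j, simReg n (.inbox j))

def Attack.sendList (T : Attack) : List (AdvReg Player 2 × AdvReg Player 2) :=
  [T.first, T.second].flatMap fun n => (Player.list.filter fun j => T.Sends n j).map fun j =>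
    (simReg n (.outbox j), .outbox 0 n.player j)

theorem Attack.mem_deliverList {T : Attack} {p : AdvReg Player 2 × AdvReg Player 2} :
    p ∈ T.deliverList ↔ ∃ n ∈ T.sim, ∃ j, p = (T.source n j, simReg n (.inbox j)) := by
  simp only [Attack.deliverList, List.mem_flatMap, List.mem_map, Player.mem_list, true_and,
    Attack.mem_sim, List.mem_cons, List.not_mem_nil, or_false, eq_comm (a := p)]

theorem Attack.mem_sendList {T : Attack} {p : AdvReg Player 2 × AdvReg Player 2} :
    p ∈ T.sendList ↔ ∃ n j, T.Sends n j ∧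
      p = (simReg n (.outbox j), .outbox 0 n.player j) := by
  simp only [Attack.sendList, List.mem_flatMap, List.mem_map, List.mem_filter, Player.mem_list,
    true_and, decide_eq_true_eq, List.mem_cons, List.not_mem_nil, or_false, eq_comm (a := p)]
  constructor
  · rintro ⟨n, -, j, h, rfl⟩; exact ⟨n, j, h, rfl⟩
  · rintro ⟨n, j, h, rfl⟩; exact ⟨n, T.mem_sim.1 h.1, j, h, rfl⟩

theorem Attack.deliver_ne (T : Attack) :
    ∀ a ∈ T.deliverList, ∀ b ∈ T.deliverList, a.1 ≠ b.2 := by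
  intro a ha b hb
  obtain ⟨n, -, j, rfl⟩ := Attack.mem_deliverList.1 ha
  obtain ⟨m, -, i, rfl⟩ := Attack.mem_deliverList.1 hb
  exact T.source_ne n m i j

theorem Attack.send_ne (T : Attack) : ∀ a ∈ T.sendList, ∀ b ∈ T.sendList, a.1 ≠ b.2 := by
  intro a ha b hb
  obtain ⟨n, j, -, rfl⟩ := Attack.mem_sendList.1 ha
  obtain ⟨m, i, -, rfl⟩ := Attack.mem_sendList.1 hb
  simp [simReg]

/-- One round of the simulation. -/
def Attack.body (T : Attack) (Q : Protocol Player) : Prog (AdvReg Player 2) :=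
  -- All deliveries precede both programs, so the simulated processes read each other's messages of
  -- the previous round, as synchrony demands.
  .seq (.copies T.deliverList) <|
  .seq ((Q.prog T.first.player).map (simReg T.first)) <|
  .seq ((Q.prog T.second.player).map (simReg T.second)) <|
  .copies T.sendList

theorem Attack.eval_deliver (T : Attack) (s : Store (AdvReg Player 2)) {n : Node}
    (hn : n ∈ T.sim) : (Prog.copies T.deliverList).eval s ∘ simReg n =
      partyWrite (fun j => s (T.source n j)) (s ∘ simReg n) := by
  funext r
  by_cases hr : ∃ j, r = .inbox j
  · obtain ⟨j, rfl⟩ := hr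
    refine Prog.eval_copies_of_mem T.deliverList s T.deliver_ne (fun a ha b hb h => ?_)
      (a := (T.source n j, simReg n (.inbox j))) (Attack.mem_deliverList.2 ⟨n, hn, j, rfl⟩)
    obtain ⟨n, -, j, rfl⟩ := Attack.mem_deliverList.1 ha
    obtain ⟨m, -, i, rfl⟩ := Attack.mem_deliverList.1 hb
    simp only [simReg_inj, PartyReg.inbox.injEq] at h
    rw [h.1, h.2]
  · push Not at hr
    have : partyWrite (fun j => s (T.source n j)) (s ∘ simReg n) r = s (simReg n r) := by
      cases r with
      | inbox j => exact absurd rfl (hr j)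
      | _ => rfl
    rw [this]
    refine Prog.eval_copies_of_notMem _ _ fun a ha h => ?_
    obtain ⟨m, -, j, rfl⟩ := Attack.mem_deliverList.1 ha
    exact hr j (simReg_inj.1 h).2.symm

theorem Attack.eval_body_sim (T : Attack) (Q : Protocol Player) (s : Store (AdvReg Player 2))
    {n : Node} (hn : n ∈ T.sim) : (T.body Q).eval s ∘ simReg n =
      (Q.prog n.player).eval (partyWrite (fun j => s (T.source n j)) (s ∘ simReg n)) := by
  have hsend : ∀ s : Store (AdvReg Player 2),
      (Prog.copies T.sendList).eval s ∘ simReg n = s ∘ simReg n := by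
    intro s
    funext r
    refine Prog.eval_copies_of_notMem _ _ fun a ha h => ?_
    obtain ⟨m, j, -, rfl⟩ := Attack.mem_sendList.1 ha
    simp [simReg] at h
  have other : ∀ (m : Node) (_ : n ≠ m) (p : Prog (PartyReg Player))
      (s : Store (AdvReg Player 2)), (p.map (simReg m)).eval s ∘ simReg n = s ∘ simReg n := by
    intro m h p s
    funext r
    exact Prog.eval_map_of_notMem (simReg_injective m) p s (simReg_notMem_range h r)
  simp only [Attack.body, Prog.eval_seq, hsend]
  rw [← T.eval_deliver s hn]
  rcases T.mem_sim.1 hn with rfl | rfl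
  · rw [other _ T.ne, Prog.eval_map (simReg_injective _)]
  · rw [Prog.eval_map (simReg_injective _), other _ T.ne.symm]

theorem Attack.eval_body_sends (T : Attack) (Q : Protocol Player) (s : Store (AdvReg Player 2))
    {n : Node} {j : Player} (h : T.Sends n j) :
    (T.body Q).eval s (.outbox 0 n.player j) = (T.body Q).eval s (simReg n (.outbox j)) := by
  simp only [Attack.body, Prog.eval_seq]
  rw [Prog.eval_copies_of_mem T.sendList _ T.send_ne (fun a ha b hb h => ?_)
    (a := (simReg n (.outbox j), .outbox 0 n.player j)) (Attack.mem_sendList.2 ⟨n, j, h, rfl⟩),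
    Prog.eval_copies_of_notMem]
  · intro a ha h
    obtain ⟨m, j, -, rfl⟩ := Attack.mem_sendList.1 ha
    simp [simReg] at h
  · obtain ⟨n, j, hn, rfl⟩ := Attack.mem_sendList.1 ha
    obtain ⟨m, i, hm, rfl⟩ := Attack.mem_sendList.1 hb
    simp only [AdvReg.outbox.injEq, true_and] at h
    obtain ⟨h, rfl⟩ := h
    rw [hn.inj hm h]

theorem Attack.eval_body_of_ne (T : Attack) (Q : Protocol Player) (s : Store (AdvReg Player 2))
    {t : AdvReg Player 2} (h₁ : ∀ n r, simReg n r ≠ t)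
    (h₂ : ∀ n j, T.Sends n j → AdvReg.outbox 0 n.player j ≠ t) : (T.body Q).eval s t = s t := by
  simp only [Attack.body, Prog.eval_seq]
  rw [Prog.eval_copies_of_notMem, Prog.eval_map_of_notMem (simReg_injective _),
    Prog.eval_map_of_notMem (simReg_injective _), Prog.eval_copies_of_notMem]
  · intro a ha
    obtain ⟨m, -, j, rfl⟩ := Attack.mem_deliverList.1 ha
    exact h₁ _ _
  · rintro ⟨r, hr⟩; exact h₁ _ _ hr
  · rintro ⟨r, hr⟩; exact h₁ _ _ hr
  · intro a ha
    obtain ⟨m, j, h, rfl⟩ := Attack.mem_sendList.1 ha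
    exact h₂ _ _ h

/-- Copying costs the length of the source, so besides the time of the two programs only the lengths
of messages matter. -/
theorem Attack.time_body_le (T : Attack) (Q : Protocol Player) (s : Store (AdvReg Player 2))
    {b q : ℕ} (h₁ : ∀ n ∈ T.sim, ∀ j, (s (T.source n j)).length ≤ b)
    (h₂ : ∀ n ∈ T.sim, (Q.prog n.player).time
      (partyWrite (fun j => s (T.source n j)) (s ∘ simReg n)) ≤ q)
    (h₃ : ∀ n ∈ T.sim, ∀ j, ((Q.prog n.player).eval
      (partyWrite (fun j => s (T.source n j)) (s ∘ simReg n)) (.outbox j)).length ≤ b) :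
    (T.body Q).time s ≤
      (T.deliverList.length + T.sendList.length) * (b + 1) + 2 + 2 * q := by
  have t₁ := Prog.time_copies_le T.deliverList s T.deliver_ne (b := b) (by
    intro a ha
    obtain ⟨n, hn, j, rfl⟩ := Attack.mem_deliverList.1 ha
    exact h₁ n hn j)
  have t₂ := h₂ _ T.first_mem
  have t₃ := h₂ _ T.second_mem
  rw [← T.eval_deliver s T.first_mem, ← Prog.time_map (simReg_injective _)] at t₂
  have e : ∀ (p : Prog (PartyReg Player)) (s : Store (AdvReg Player 2)),
      (p.map (simReg T.first)).eval s ∘ simReg T.second = s ∘ simReg T.second := by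
    intro p s
    funext r
    exact Prog.eval_map_of_notMem (simReg_injective _) p s (simReg_notMem_range T.ne.symm r)
  rw [← T.eval_deliver s T.second_mem, ← e (Q.prog T.first.player),
    ← Prog.time_map (simReg_injective _)] at t₃
  have t₄ := Prog.time_copies_le T.sendList
    (((Q.prog T.second.player).map (simReg T.second)).eval
      (((Q.prog T.first.player).map (simReg T.first)).eval ((Prog.copies T.deliverList).eval s)))
    T.send_ne (b := b) (by
    intro a ha
    have hf := ha
    obtain ⟨n, j, hn, rfl⟩ := Attack.mem_sendList.1 ha
    have h := h₃ n hn.1 j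
    rw [← T.eval_body_sim Q s hn.1, Function.comp_apply] at h
    simp only [Attack.body, Prog.eval_seq] at h
    rwa [Prog.eval_copies_of_notMem] at h
    intro a ha h
    obtain ⟨m, j, -, rfl⟩ := Attack.mem_sendList.1 ha
    simp [simReg] at h)
  simp only [Attack.body, Prog.time_seq]
  rw [Nat.add_mul]
  omega

/-! ### Preparation of the simulated memories -/

def pushInput (n : Node) : Prog (AdvReg Player 2) :=
  match n with
  | .a₀ => .push (simReg n .input) false
  | .b => .skip
  | .c => .skip
  | .a₁ => .push (simReg n .input) true

theorem eval_pushInput_of_ne (n : Node) (s : Store (AdvReg Player 2)) {t : AdvReg Player 2}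
    (h : t ≠ simReg n .input) : (pushInput n).eval s t = s t := by
  cases n <;> simp [pushInput, Function.update_of_ne h]

theorem eval_pushInput (n : Node) (s : Store (AdvReg Player 2)) (h : s (simReg n .input) = []) :
    (pushInput n).eval s (simReg n .input) = n.input := by
  cases n <;> simp [pushInput, h, Node.input]

theorem time_pushInput (n : Node) (s : Store (AdvReg Player 2)) : (pushInput n).time s = 1 := by
  cases n <;> rfl

def Attack.setupList (T : Attack) : List (AdvReg Player 2 × AdvReg Player 2) :=
  [(.secParam, simReg T.first .secParam), (.secParam, simReg T.second .secParam),
    (.setup T.first.player, simReg T.first .setup),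
    (.setup T.second.player, simReg T.second .setup),
    (.sid 0, simReg T.first .sid), (.sid 0, simReg T.second .sid),
    (.coins, simReg T.second .coins)]

/-- Prepare the memories of the simulated processes. The first one takes its random bits from the
process of its player in execution `1`, the second one from the adversary's own bits. -/
def Attack.prepare (T : Attack) : Prog (AdvReg Player 2) :=
  .seq (.copies T.setupList) <|
  -- `AdvPolyTime` only bounds the length of the borrowed bits, whereas the protocol's time bound
  -- needs the exact length. `transfer` clocked by the own coins pads or truncates; doing it twice
  -- undoes the reversal.
  .seq (.transfer .coins (.procCoins 1 T.first.player) (.output 1 .C)) <|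
  .seq (.transfer .coins (.output 1 .C) (simReg T.first .coins)) <|
  .seq (pushInput T.first) <|
  .seq (pushInput T.second) <|
  -- A nonempty flag marks the preparation as done, so it runs in the first activation only.
  .push (.output 1 .A) true

/-- The random bits of the simulated processes. -/
def Attack.coins (T : Attack) (c : Fin 2 → Player → Str) (a : Str) (n : Node) : Str :=
  if n = T.first then transfer a.length (transfer a.length (c 1 T.first.player) []) [] else a

theorem Attack.length_coins (T : Attack) (c : Fin 2 → Player → Str) (a : Str) (n : Node) :
    (T.coins c a n).length = a.length := by
  unfold Attack.coins
  split_ifs <;> simp [length_transfer]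

theorem Attack.coins_first (T : Attack) (c : Fin 2 → Player → Str) (a : Str)
    (h : (c 1 T.first.player).length = a.length) :
    T.coins c a T.first = c 1 T.first.player := by
  rw [Attack.coins, if_pos rfl]
  nth_rw 2 [← h]
  rw [transfer_eq_reverse, List.append_nil, ← h]
  nth_rw 1 [← List.length_reverse]
  rw [transfer_eq_reverse, List.append_nil, List.reverse_reverse]

theorem Attack.setup_ne (T : Attack) : ∀ a ∈ T.setupList, ∀ b ∈ T.setupList, a.1 ≠ b.2 := by
  intro a ha b hb
  simp only [Attack.setupList, List.mem_cons, List.not_mem_nil, or_false] at ha hb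
  rcases ha with rfl | rfl | rfl | rfl | rfl | rfl | rfl <;>
  rcases hb with rfl | rfl | rfl | rfl | rfl | rfl | rfl <;> simp [simReg]

theorem Attack.eval_setupList (T : Attack) (s : Store (AdvReg Player 2))
    {a : AdvReg Player 2 × AdvReg Player 2} (ha : a ∈ T.setupList) :
    (Prog.copies T.setupList).eval s a.2 = s a.1 := by
  refine Prog.eval_copies_of_mem _ _ T.setup_ne (fun a ha b hb => ?_) ha
  have := T.ne
  have := T.ne.symm
  simp only [Attack.setupList, List.mem_cons, List.not_mem_nil, or_false] at ha hb
  rcases ha with rfl | rfl | rfl | rfl | rfl | rfl | rfl <;>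
  rcases hb with rfl | rfl | rfl | rfl | rfl | rfl | rfl <;> simp [*]

theorem Attack.eval_prepare_of_ne (T : Attack) (s : Store (AdvReg Player 2))
    {t : AdvReg Player 2} (h₁ : ∀ n r, t ≠ simReg n r) (h₂ : t ≠ .procCoins 1 T.first.player)
    (h₃ : t ≠ .output 1 .C) (h₄ : t ≠ .output 1 .A) : T.prepare.eval s t = s t := by
  simp only [Attack.prepare, Prog.eval_seq, Prog.eval_push]
  rw [Function.update_of_ne h₄, eval_pushInput_of_ne _ _ (h₁ _ _),
    eval_pushInput_of_ne _ _ (h₁ _ _), Prog.eval_transfer_of_ne _ _ _ _ h₃ (h₁ _ _),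
    Prog.eval_transfer_of_ne _ _ _ _ h₂ h₃, Prog.eval_copies_of_notMem]
  intro a ha h
  simp only [Attack.setupList, List.mem_cons, List.not_mem_nil, or_false] at ha
  rcases ha with rfl | rfl | rfl | rfl | rfl | rfl | rfl <;> exact h₁ _ _ h.symm

theorem Attack.eval_prepare_flag (T : Attack) (s : Store (AdvReg Player 2)) :
    T.prepare.eval s (.output 1 .A) ≠ [] := by
  simp [Attack.prepare]

theorem Attack.eval_prepare_sim (T : Attack) {k : ℕ} {sid : Fin 2 → Str} {x : Fin 2 → Bool}
    {τ : Player → Str} {c : Fin 2 → Player → Str} {a : Str} (inc : Fin 2 → Player → Player → Str)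
    {n : Node} (hn : n ∈ T.sim) :
    T.prepare.eval (advWrite inc (advInit k sid x τ c a)) ∘ simReg n =
      pathInit k τ (sid 0) (T.coins c a) n := by
  set s := advWrite inc (advInit k sid x τ c a) with hs
  have hs₁ : ∀ n r, s (simReg n r) = [] := fun n r => rfl
  have hnf := T.ne
  have hfn := T.ne.symm
  have hset : ∀ {a : AdvReg Player 2 × AdvReg Player 2}, a ∈ T.setupList →
      (Prog.copies T.setupList).eval s a.2 = s a.1 := T.eval_setupList s
  have hnot : ∀ {t}, (∀ a ∈ T.setupList, a.2 ≠ t) →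
      (Prog.copies T.setupList).eval s t = s t := Prog.eval_copies_of_notMem _ s
  funext r
  simp only [Function.comp_apply, Attack.prepare, Prog.eval_seq, Prog.eval_push]
  rw [Function.update_of_ne (by simp [simReg])]
  by_cases hc : n = T.first ∧ r = .coins
  · obtain ⟨rfl, rfl⟩ := hc
    rw [eval_pushInput_of_ne _ _ (by simp), eval_pushInput_of_ne _ _ (by simp),
      Prog.eval_transfer _ (by simp [simReg]), Prog.eval_transfer _ (by simp),
      Prog.eval_transfer_of_ne _ _ _ _ (by simp) (by simp),
      Prog.eval_transfer_of_ne _ _ _ _ (by simp [simReg]) (by simp [simReg])]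
    rw [hnot (t := .coins), hnot (t := .procCoins 1 T.first.player), hnot (t := .output 1 .C),
      hnot (t := simReg T.first .coins), hs₁]
    · simp [pathInit, partyInit, Attack.coins, hs, advWrite, advInit]
    all_goals
      intro a ha
      simp only [Attack.setupList, List.mem_cons, List.not_mem_nil, or_false] at ha
      rcases ha with rfl | rfl | rfl | rfl | rfl | rfl | rfl <;> simp [simReg_inj, hfn] <;>
        simp [simReg]
  · have htr : ∀ (s : Store (AdvReg Player 2)),
        (Prog.transfer .coins (.output 1 .C) (simReg T.first .coins)).eval
          ((Prog.transfer .coins (.procCoins 1 T.first.player) (.output 1 .C)).eval s)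
          (simReg n r) = s (simReg n r) := by
      intro s
      rw [Prog.eval_transfer_of_ne _ _ _ _ (by simp [simReg]) (by simpa using hc),
        Prog.eval_transfer_of_ne _ _ _ _ (by simp [simReg]) (by simp [simReg])]
    by_cases hi : r = .input
    · subst hi
      have h0 : (Prog.copies T.setupList).eval s (simReg n .input) = [] := by
        rw [hnot, hs₁]
        intro a ha
        simp only [Attack.setupList, List.mem_cons, List.not_mem_nil, or_false] at ha
        rcases ha with rfl | rfl | rfl | rfl | rfl | rfl | rfl <;> simp
      rcases T.mem_sim.1 hn with rfl | rfl
      · rw [eval_pushInput_of_ne _ _ (by simp [hnf]), eval_pushInput _ _ (by rw [htr, h0])]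
        rfl
      · rw [eval_pushInput, pathInit, partyInit]
        rw [eval_pushInput_of_ne _ _ (by simp [hfn]), htr, h0]
    · rw [eval_pushInput_of_ne _ _ (by simp [hi]), eval_pushInput_of_ne _ _ (by simp [hi]), htr]
      by_cases hm : ∃ a ∈ T.setupList, a.2 = simReg n r
      · obtain ⟨p, hp, hpr⟩ := hm
        rw [← hpr, hset hp]
        simp only [Attack.setupList, List.mem_cons, List.not_mem_nil, or_false] at hp
        rcases hp with rfl | rfl | rfl | rfl | rfl | rfl | rfl <;>
          obtain ⟨rfl, rfl⟩ := simReg_inj.1 hpr <;>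
          simp [pathInit, partyInit, Attack.coins, hs, advWrite, advInit, hfn]
      · push Not at hm
        -- A register that nothing writes is still empty, which is also its content in `partyInit`.
        rw [hnot hm, hs₁]
        rcases T.mem_sim.1 hn with rfl | rfl <;> cases r <;>
          simp [Attack.setupList, pathInit, partyInit] at hm hi hc ⊢

theorem Attack.time_prepare_le (T : Attack) {k : ℕ} {sid : Fin 2 → Str} {x : Fin 2 → Bool}
    {τ : Player → Str} {c : Fin 2 → Player → Str} {a : Str} (inc : Fin 2 → Player → Player → Str)
    {b : ℕ} (hk : k ≤ b) (hsid : ∀ l, (sid l).length ≤ b) (hτ : ∀ i, (τ i).length ≤ b)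
    (ha : a.length ≤ b) :
    T.prepare.time (advWrite inc (advInit k sid x τ c a)) ≤ 15 * (b + 1) + 6 := by
  set s := advWrite inc (advInit k sid x τ c a) with hs
  have h₁ := Prog.time_copies_le T.setupList s T.setup_ne (b := b) (by
    intro p hp
    simp only [Attack.setupList, List.mem_cons, List.not_mem_nil, or_false] at hp
    rcases hp with rfl | rfl | rfl | rfl | rfl | rfl | rfl <;>
      simp [advWrite, advInit, unary, *])
  set s₁ := (Prog.copies T.setupList).eval s with hs₁
  have e₁ : s₁ .coins = a := by
    rw [hs₁, Prog.eval_copies_of_notMem]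
    · rfl
    · intro p hp
      simp only [Attack.setupList, List.mem_cons, List.not_mem_nil, or_false] at hp
      rcases hp with rfl | rfl | rfl | rfl | rfl | rfl | rfl <;> simp [simReg]
  have h₂ := Prog.time_transfer_le .coins (.procCoins 1 T.first.player) (.output 1 .C) s₁
  set s₂ := (Prog.transfer .coins (.procCoins 1 T.first.player) (.output 1 .C)).eval s₁ with hs₂
  have e₂ : s₂ .coins = a := by
    rw [hs₂, Prog.eval_transfer_of_ne _ _ _ _ (by simp) (by simp), e₁]
  have h₃ := Prog.time_transfer_le .coins (.output 1 .C) (simReg T.first .coins) s₂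
  rw [e₁] at h₂
  rw [e₂] at h₃
  have hl : T.setupList.length = 7 := rfl
  rw [hl] at h₁
  simp only [Attack.prepare, Prog.time_seq, time_pushInput, Prog.time_push, ← hs₁, ← hs₂]
  omega

/-- The program of the adversary. -/
def Attack.prog (T : Attack) (Q : Protocol Player) : Prog (AdvReg Player 2) :=
  .seq (.branch (.output 1 .A) T.prepare .skip .skip) (T.body Q)

/-- Its own random bits are exactly those of one process, because the other simulated process
borrows its bits from execution `1`. -/
def Attack.machine (T : Attack) (Q : Protocol Player) : Machine (AdvReg Player 2) where
  prog := T.prog Q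
  coinLen := Q.coinLen

/-- The messages of execution `0` that reach the simulated processes. -/
abbrev execZero (inc : ℕ → Fin 2 → Player → Player → Str) (r : ℕ) : Player → Player → Str :=
  inc r 0

/-! ### Invariant and running time of the simulation -/

section Invariant

variable {Q : Protocol Player} {q : Polynomial ℕ}

/-- The memory `s` of the adversary before round `r` agrees with the memories `G` of the simulated
processes. -/
structure Attack.Agrees (T : Attack) (s₀ : Store (AdvReg Player 2)) (r : ℕ)
    (G : Node → Store (PartyReg Player)) (s : Store (AdvReg Player 2)) : Prop where
  -- Before the first activation the simulated memories are not yet in place, so the agreement `sim`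
  -- is required only once the flag is set.
  start : s (.output 1 .A) = [] → r = 0 ∧ s = s₀
  empty : s (.output 1 .B) = []
  sim : s (.output 1 .A) ≠ [] → ∀ n ∈ T.sim, s ∘ simReg n = G n
  sends : ∀ n j, T.Sends n j → s (.outbox 0 n.player j) = G n (.outbox j)
  silent : ∀ i j, (∀ n, T.Sends n j → n.player ≠ i) → s (.outbox 0 i j) = []

/-- The memory of the adversary after the preparation. -/
def Attack.prepared (T : Attack) (s : Store (AdvReg Player 2)) : Store (AdvReg Player 2) :=
  (Prog.branch (.output 1 .A) T.prepare .skip .skip).eval s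

theorem Attack.prepared_of_ne (T : Attack) (s : Store (AdvReg Player 2)) {t : AdvReg Player 2}
    (h₁ : ∀ n r, t ≠ simReg n r) (h₂ : t ≠ .procCoins 1 T.first.player)
    (h₃ : t ≠ .output 1 .C) (h₄ : t ≠ .output 1 .A) : T.prepared s t = s t := by
  rw [Attack.prepared, Prog.eval_branch]
  split
  · exact T.eval_prepare_of_ne s h₁ h₂ h₃ h₄
  · rfl
  · rfl

theorem Attack.prepared_flag (T : Attack) (s : Store (AdvReg Player 2)) :
    T.prepared s (.output 1 .A) ≠ [] := by
  rw [Attack.prepared, Prog.eval_branch]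
  split
  · exact T.eval_prepare_flag s
  · rename_i h; simp [h]
  · rename_i h; simp [h]

variable {T : Attack} {k : ℕ} {sid : Fin 2 → Str} {x : Fin 2 → Bool} {τ : Player → Str}
  {c : Fin 2 → Player → Str} {a : Str}

theorem Attack.Agrees.prepared_sim {r : ℕ} {G : Node → Store (PartyReg Player)}
    {s : Store (AdvReg Player 2)} (h : T.Agrees (advInit k sid x τ c a) r G s)
    (h0 : r = 0 → G = pathInit k τ (sid 0) (T.coins c a))
    (inc : Fin 2 → Player → Player → Str) {n : Node} (hn : n ∈ T.sim) :
    T.prepared (advWrite inc s) ∘ simReg n = G n := by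
  rw [Attack.prepared, Prog.eval_branch]
  split
  · rename_i hf
    obtain ⟨hr, rfl⟩ := h.start hf
    rw [T.eval_prepare_sim inc hn, h0 hr]
  all_goals
    rename_i hf
    exact h.sim (fun he => by rw [show s (.output 1 .A) = _ from hf] at he; simp at he) n hn

/-- The adversary copies simulated messages whole while `incoming` truncates them; the length bound
`hG` makes the two coincide. -/
theorem Attack.Agrees.prepared_source {r len : ℕ} {G : Node → Store (PartyReg Player)}
    {s : Store (AdvReg Player 2)} (h : T.Agrees (advInit k sid x τ c a) r G s)
    (h0 : r = 0 → G = pathInit k τ (sid 0) (T.coins c a))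
    (hG : ∀ n ∈ T.sim, ∀ j, (G n (.outbox j)).length ≤ len)
    (inc : Fin 2 → Player → Player → Str) {n : Node} (j : Player) :
    T.prepared (advWrite inc s) (T.source n j) = incoming T.sim len (inc 0) G n j := by
  unfold Attack.source incoming
  split
  · rw [T.prepared_of_ne _ (by simp [simReg]) (by simp) (by simp) (by simp)]
    exact h.empty
  · rename_i m hm
    split_ifs with hs
    · rw [List.take_of_length_le (hG m hs _), ← h.prepared_sim h0 inc hs]
      rfl
    · rw [T.prepared_of_ne _ (by simp [simReg]) (by simp) (by simp) (by simp)]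
      rfl

theorem Attack.Agrees.step {r len : ℕ} {G : Node → Store (PartyReg Player)}
    {s : Store (AdvReg Player 2)} (h : T.Agrees (advInit k sid x τ c a) r G s)
    (h0 : r = 0 → G = pathInit k τ (sid 0) (T.coins c a))
    (hG : ∀ n ∈ T.sim, ∀ j, (G n (.outbox j)).length ≤ len)
    (inc : Fin 2 → Player → Player → Str) :
    T.Agrees (advInit k sid x τ c a) (r + 1)
      (fun n => (Q.prog n.player).eval (partyWrite (incoming T.sim len (inc 0) G n) (G n)))
      ((T.prog Q).eval (advWrite inc s)) := by
  have he : (T.prog Q).eval (advWrite inc s) = (T.body Q).eval (T.prepared (advWrite inc s)) := rfl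
  have hsim : ∀ n ∈ T.sim, (T.prog Q).eval (advWrite inc s) ∘ simReg n =
      (Q.prog n.player).eval (partyWrite (incoming T.sim len (inc 0) G n) (G n)) := by
    intro n hn
    rw [he, T.eval_body_sim Q _ hn, h.prepared_sim h0 inc hn]
    congr 2
    funext j
    exact h.prepared_source h0 hG inc j
  have hflag : (T.prog Q).eval (advWrite inc s) (.output 1 .A) ≠ [] := by
    rw [he, T.eval_body_of_ne Q _ (by simp [simReg]) (by simp)]
    exact T.prepared_flag _
  refine ⟨fun hf => absurd hf hflag, ?_, fun _ => hsim, fun n j hn => ?_, fun i j hij => ?_⟩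
  · rw [he, T.eval_body_of_ne Q _ (by simp [simReg]) (by simp),
      T.prepared_of_ne _ (by simp [simReg]) (by simp) (by simp) (by simp)]
    exact h.empty
  · rw [← hsim n hn.1, he, T.eval_body_sends Q _ hn]
    rfl
  · rw [he, T.eval_body_of_ne Q _ (by simp [simReg]) (fun n j' hn hnj => ?_),
      T.prepared_of_ne _ (by simp [simReg]) (by simp) (by simp) (by simp)]
    · exact h.silent i j hij
    · simp only [AdvReg.outbox.injEq, true_and] at hnj
      obtain ⟨hni, rfl⟩ := hnj
      exact hij n hn hni

theorem Attack.agrees_init : T.Agrees (advInit k sid x τ c a) 0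
    (pathInit k τ (sid 0) (T.coins c a)) (advInit k sid x τ c a) :=
  ⟨fun _ => ⟨rfl, rfl⟩, rfl, fun h => absurd rfl h, fun _ _ _ => rfl, fun _ _ _ => rfl⟩

/-- The bound `q` on the time of a process, as in `Protocol.PolyTime`. -/
def Protocol.TimeBound (Q : Protocol Player) (q : Polynomial ℕ) : Prop :=
  ∀ (k : ℕ) (i : Player) (τ sid input coins : Str) (inc : ℕ → Player → Str),
    τ.length ≤ Q.setupLen.eval k → sid.length ≤ Q.sidLen.eval k → input.length ≤ 1 →
    coins.length = Q.coinLen.eval k → (∀ r j, (inc r j).length ≤ Q.msgLen.eval k) →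
    ∀ r < Q.rounds.eval k,
      (Q.prog i).time (partyWrite (inc r)
        (trajectory (Q.prog i) (fun r => partyWrite (inc r))
          (partyInit k τ sid input coins) r)) ≤ q.eval k ∧
      ∀ j, (trajectory (Q.prog i) (fun r => partyWrite (inc r))
          (partyInit k τ sid input coins) (r + 1) (.outbox j)).length ≤ Q.msgLen.eval k

theorem Protocol.TimeBound.pathRun (hQ : Q.TimeBound q) {k : ℕ} {τ : Player → Str} {sid : Str}
    {coins : Node → Str} (S : Finset Node) {ext : ℕ → Player → Player → Str}
    (hτ : ∀ i, (τ i).length ≤ Q.setupLen.eval k) (hsid : sid.length ≤ Q.sidLen.eval k)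
    {n : Node} (hcoins : (coins n).length = Q.coinLen.eval k)
    (hext : ∀ r i j, (ext r i j).length ≤ Q.msgLen.eval k) {r : ℕ} (hr : r < Q.rounds.eval k) :
    (Q.prog n.player).time (partyWrite (incoming S (Q.msgLen.eval k) (ext r)
        (pathRun Q S (Q.msgLen.eval k) ext (pathInit k τ sid coins) r) n)
      (pathRun Q S (Q.msgLen.eval k) ext (pathInit k τ sid coins) r n)) ≤ q.eval k ∧
    ∀ j, (pathRun Q S (Q.msgLen.eval k) ext (pathInit k τ sid coins) (r + 1) n
      (.outbox j)).length ≤ Q.msgLen.eval k := by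
  have := hQ k n.player (τ n.player) sid n.input (coins n)
    (fun r => incoming S (Q.msgLen.eval k) (ext r)
      (ABG.pathRun Q S (Q.msgLen.eval k) ext (pathInit k τ sid coins) r) n)
    (hτ _) hsid n.length_input_le hcoins (fun r j => length_incoming_le (hext r) _ _ _) r hr
  rw [pathRun_eq_trajectory, pathRun_eq_trajectory]
  exact this

theorem Protocol.TimeBound.length_outbox_le (hQ : Q.TimeBound q) {k : ℕ} {τ : Player → Str}
    {sid : Str} {coins : Node → Str} (S : Finset Node) {ext : ℕ → Player → Player → Str}
    (hτ : ∀ i, (τ i).length ≤ Q.setupLen.eval k) (hsid : sid.length ≤ Q.sidLen.eval k)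
    {n : Node} (hcoins : (coins n).length = Q.coinLen.eval k)
    (hext : ∀ r i j, (ext r i j).length ≤ Q.msgLen.eval k) {r : ℕ} (hr : r ≤ Q.rounds.eval k)
    (j : Player) :
    (ABG.pathRun Q S (Q.msgLen.eval k) ext (pathInit k τ sid coins) r n
      (.outbox j)).length ≤ Q.msgLen.eval k := by
  rcases r with _ | r
  · exact Nat.zero_le _
  · exact (hQ.pathRun S hτ hsid hcoins hext (Nat.lt_of_succ_le hr)).2 j

theorem Attack.agrees_trajectory (hQ : Q.TimeBound q) {inc : ℕ → Fin 2 → Player → Player → Str}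
    (hτ : ∀ i, (τ i).length ≤ Q.setupLen.eval k) (hsid : (sid 0).length ≤ Q.sidLen.eval k)
    (ha : a.length = Q.coinLen.eval k)
    (hinc : ∀ r l i j, (inc r l i j).length ≤ Q.msgLen.eval k) {r : ℕ}
    (hr : r ≤ Q.rounds.eval k) :
    T.Agrees (advInit k sid x τ c a) r
      (ABG.pathRun Q T.sim (Q.msgLen.eval k) (execZero inc) (pathInit k τ (sid 0) (T.coins c a)) r)
      (trajectory (T.prog Q) (fun r => advWrite (inc r)) (advInit k sid x τ c a) r) := by
  induction r with
  | zero => exact Attack.agrees_init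
  | succ r ih =>
    refine (ih (Nat.le_of_succ_le hr)).step ?_ (fun n hn j => ?_) (inc r)
    · rintro rfl; rfl
    · exact hQ.length_outbox_le T.sim hτ hsid ((T.length_coins _ _ _).trans ha)
        (fun r i j => hinc r 0 i j) (Nat.le_of_succ_le hr) j

/-- The bound must cover all data and messages of admissible length, not only those of a genuine
execution. Even then the simulated processes form a joint run with bounded messages and random bits
of exact length, so the protocol's own bound applies to both. -/
theorem Attack.advPolyTime (T : Attack) (hQ : Q.TimeBound q) : AdvPolyTime Q (T.machine Q) := by
  -- One bound for every string that the adversary copies or moves.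
  let b : Polynomial ℕ := Polynomial.X + Q.sidLen + Q.setupLen + Q.coinLen + Q.msgLen
  refine ⟨15 * (b + 1) + 10 + Polynomial.C (T.deliverList.length + T.sendList.length) * (b + 1) +
    2 * q, ?_⟩
  intro k sid x τ c a inc hsid hτ hc ha hinc r hr
  have hag := Attack.agrees_trajectory (T := T) (x := x) (c := c) hQ hτ (hsid 0) ha hinc hr.le
  set s := trajectory (T.machine Q).prog (fun r => advWrite (inc r)) (advInit k sid x τ c a) r
  set G := ABG.pathRun Q T.sim (Q.msgLen.eval k) (execZero inc)
    (pathInit k τ (sid 0) (T.coins c a)) with hGdef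
  change T.Agrees (advInit k sid x τ c a) r (G r) s at hag
  have h0 : r = 0 → G r = pathInit k τ (sid 0) (T.coins c a) := by rintro rfl; rfl
  have hbd : b.eval k = k + Q.sidLen.eval k + Q.setupLen.eval k + Q.coinLen.eval k +
      Q.msgLen.eval k := by simp [b]
  have hext : ∀ r i j, (execZero inc r i j).length ≤ Q.msgLen.eval k := fun r i j => hinc r 0 i j
  have hlen : ∀ n j, (G r n (.outbox j)).length ≤ Q.msgLen.eval k := fun n j =>
    hQ.length_outbox_le T.sim hτ (hsid 0) ((T.length_coins _ _ _).trans ha) hext hr.le j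
  have hsrc : ∀ n j, T.prepared (advWrite (inc r) s) (T.source n j) =
      incoming T.sim (Q.msgLen.eval k) (execZero inc r) (G r) n j := fun n j =>
    hag.prepared_source h0 (fun n _ j => hlen n j) (inc r) j
  have hstep : ∀ n ∈ T.sim, partyWrite (fun j => T.prepared (advWrite (inc r) s) (T.source n j))
      (T.prepared (advWrite (inc r) s) ∘ simReg n) =
      partyWrite (incoming T.sim (Q.msgLen.eval k) (execZero inc r) (G r) n) (G r n) := by
    intro n hn
    rw [hag.prepared_sim h0 (inc r) hn]
    congr 1
    funext j
    exact hsrc n j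
  have hrun := fun n => hQ.pathRun (n := n) T.sim hτ (hsid 0)
    ((T.length_coins c a n).trans ha) hext hr
  have hbody := T.time_body_le Q (T.prepared (advWrite (inc r) s)) (b := b.eval k) (q := q.eval k)
    (fun n _ j => by
      rw [hsrc, hbd]
      exact (length_incoming_le (hext r) _ _ _).trans (Nat.le_add_left _ _))
    (fun n hn => by rw [hstep n hn]; exact (hrun n).1)
    (fun n hn j => by
      rw [hstep n hn, hbd]
      exact ((hrun n).2 j).trans (Nat.le_add_left _ _))
  have hprep : (Prog.branch (.output 1 .A) T.prepare .skip .skip).time (advWrite (inc r) s) ≤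
      15 * (b.eval k + 1) + 8 := by
    rw [Prog.time_branch]
    split
    · rename_i hf
      obtain ⟨-, hs⟩ := hag.start hf
      rw [hs]
      have := T.time_prepare_le (x := x) (c := c) (inc r) (k := k) (sid := sid) (τ := τ) (a := a)
        (b := b.eval k) (by omega) (fun l => (hsid l).trans (by omega))
        (fun i => (hτ i).trans (by omega)) (by have : a.length = Q.coinLen.eval k := ha; omega)
      exact (Nat.add_le_add_right this 1).trans (by omega)
    · simp
    · simp
  have ht : (T.machine Q).prog.time (advWrite (inc r) s) =
      (Prog.branch (.output 1 .A) T.prepare .skip .skip).time (advWrite (inc r) s) +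
      (T.body Q).time (T.prepared (advWrite (inc r) s)) := rfl
  rw [ht]
  simp only [Polynomial.eval_add, Polynomial.eval_mul, Polynomial.eval_C, Polynomial.eval_ofNat,
    Polynomial.eval_one]
  omega

end Invariant

/-! ## The attacked execution -/

open Classical in
/-- The setup tapes that the adversary learns. -/
noncomputable def Attack.knownSetup (T : Attack) (τ : Player → Str) (i : Player) : Str :=
  if T.pattern.Faulty i then τ i else []

open Classical in
/-- The random bits of processes that the adversary learns. -/
noncomputable def Attack.knownCoins (T : Attack) (c : Fin 2 → Player → Str) (l : Fin 2)
    (i : Player) : Str :=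
  if T.pattern.Faulty i ∧ i ∉ T.pattern l then c l i else []

/-- The random bits of all the processes of the path. -/
def Attack.assign {V : Type} (T : Attack) (c : Fin 2 → Player → V) (a : V) (n : Node) : V :=
  if n = T.first then c 1 n.player else if n = T.second then a else c 0 n.player

theorem Attack.coins_knownCoins (T : Attack) {c : Fin 2 → Player → Str} {a : Str}
    (hc : ∀ l i, (c l i).length = a.length) {n : Node} (hn : n ∈ T.sim) :
    T.coins (T.knownCoins c) a n = T.assign c a n := by
  rcases T.mem_sim.1 hn with rfl | rfl
  · have : T.knownCoins c 1 T.first.player = c 1 T.first.player :=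
      if_pos ⟨T.faulty _ T.first_mem, T.first_notMem⟩
    rw [T.coins_first _ _ (by rw [this, hc]), this, Attack.assign, if_pos rfl]
  · rw [Attack.coins, if_neg T.ne.symm, Attack.assign, if_neg T.ne.symm, if_pos rfl]

section Run

variable {Q : Protocol Player} {q : Polynomial ℕ}

open Classical in
-- Treating the delivered messages as a given sequence decouples the adversary from the other
-- processes, so the simulation invariant applies to its run.
theorem Global.adv_iterate_step (Z : Pattern Player 2) (M : Machine (AdvReg Player 2)) (len : ℕ)
    (G : Global Player 2) (r : ℕ) :
    ((Global.step Q Z M len)^[r] G).adv = trajectory M.prog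
      (fun r => advWrite fun l i j =>
        if Z.Faulty i then ((Global.step Q Z M len)^[r] G).msg Z len l j i else []) G.adv r := by
  induction r with
  | zero => rfl
  | succ r ih =>
    rw [trajectory, ← ih, Function.iterate_succ_apply']
    rfl

theorem Global.length_msg_le (Z : Pattern Player 2) (len : ℕ) (G : Global Player 2) (l : Fin 2)
    (i j : Player) : (G.msg Z len l i j).length ≤ len :=
  List.length_take_le _ _

/-- The joint run of the whole path. -/
def fullRun (Q : Protocol Player) (k : ℕ) (τ : Player → Str) (sid : Str) (coins : Node → Str) :
    ℕ → Node → Store (PartyReg Player) :=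
  pathRun Q Finset.univ (Q.msgLen.eval k) (fun _ _ _ => []) (pathInit k τ sid coins)

/-- The path is cut into simulated and honest processes, and both sides are followed round by round.
Messages across the cut pass through the adversary unchanged. -/
theorem Attack.proc_eq_fullRun (T : Attack) (hQ : Q.TimeBound q) {k : ℕ} {sid : Fin 2 → Str}
    {x : Fin 2 → Bool} {τ : Player → Str} {c : Fin 2 → Player → Str} {a : Str}
    (hτ : ∀ i, (τ i).length ≤ Q.setupLen.eval k) (hsid : (sid 0).length ≤ Q.sidLen.eval k)
    (ha : a.length = Q.coinLen.eval k) (hc : ∀ l i, (c l i).length = Q.coinLen.eval k)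
    (hx : ∀ m ∉ T.sim, m.input = if m.player = .A then [x 0] else []) {m : Node}
    (hm : m ∉ T.sim) :
    ((Global.step Q T.pattern (T.machine Q) (Q.msgLen.eval k))^[Q.rounds.eval k]
      (Global.init .A T.pattern k sid x τ c a)).proc 0 m.player =
    fullRun Q k τ (sid 0) (T.assign c a) (Q.rounds.eval k) m := by
  classical
  set len := Q.msgLen.eval k with hlen
  set G : ℕ → Global Player 2 := fun r =>
    (Global.step Q T.pattern (T.machine Q) len)^[r] (Global.init .A T.pattern k sid x τ c a)
    with hG
  set P := fullRun Q k τ (sid 0) (T.assign c a) with hP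
  let inc : ℕ → Fin 2 → Player → Player → Str := fun r l i j =>
    if T.pattern.Faulty i then (G r).msg T.pattern len l j i else []
  have hinc : ∀ r l i j, (inc r l i j).length ≤ len := by
    intro r l i j
    simp only [inc]
    split_ifs
    · exact Global.length_msg_le _ _ _ _ _ _
    · exact Nat.zero_le _
  have hτ' : ∀ i, (T.knownSetup τ i).length ≤ Q.setupLen.eval k := by
    intro i
    unfold Attack.knownSetup
    split_ifs
    · exact hτ i
    · exact Nat.zero_le _
  set S := pathRun Q T.sim len (execZero inc)
    (pathInit k (T.knownSetup τ) (sid 0) (T.coins (T.knownCoins c) a)) with hS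
  have hadv : ∀ r ≤ Q.rounds.eval k, T.Agrees
      (advInit k sid x (T.knownSetup τ) (T.knownCoins c) a) r (S r) (G r).adv := by
    intro r hr
    have h := Attack.agrees_trajectory (T := T) (x := x) (c := T.knownCoins c) hQ hτ' hsid ha
      hinc hr
    rw [hG]
    simp only
    rw [Global.adv_iterate_step]
    exact h
  -- Both halves must be proved together, since each receives messages from the other.
  have key : ∀ r ≤ Q.rounds.eval k, (∀ n ∈ T.sim, P r n = S r n) ∧
      ∀ m ∉ T.sim, P r m = (G r).proc 0 m.player := by
    intro r
    induction r with
    | zero =>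
      refine fun _ => ⟨fun n hn => ?_, fun m hm => ?_⟩
      · change pathInit _ _ _ _ n = pathInit _ _ _ _ n
        have : T.knownSetup τ n.player = τ n.player := if_pos (T.faulty n hn)
        rw [pathInit, pathInit, this, T.coins_knownCoins (fun l i => (hc l i).trans ha.symm) hn]
      · change pathInit _ _ _ _ m = partyInit _ _ _ _ _
        have h := hm
        rw [T.mem_sim, not_or] at h
        rw [pathInit, hx m hm, Attack.assign, if_neg h.1, if_neg h.2]
    | succ r ih =>
      intro hr
      obtain ⟨ih₁, ih₂⟩ := ih (Nat.le_of_succ_le hr)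
      have hag := hadv r (Nat.le_of_succ_le hr)
      refine ⟨fun n hn => ?_, fun m hm => ?_⟩
      · change (Q.prog n.player).eval (partyWrite (incoming _ len _ (P r) n) (P r n)) =
          (Q.prog n.player).eval (partyWrite (incoming T.sim len (inc r 0) (S r) n) (S r n))
        rw [ih₁ n hn]
        congr 2
        funext j
        unfold incoming
        split
        · rfl
        · rename_i m hm
          rw [if_pos (Finset.mem_univ m)]
          split_ifs with hms
          · rw [ih₁ m hms]
          · simp only [inc]
            rw [if_pos (show T.pattern.Faulty n.player from T.faulty n hn), Global.msg,
              if_neg, ih₂ m hms, Node.player_of_peer hm]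
            rw [← Node.player_of_peer hm]
            exact T.honest m hms
      · have : G (r + 1) = Global.step Q T.pattern (T.machine Q) len (G r) :=
          Function.iterate_succ_apply' _ _ _
        rw [this]
        change (Q.prog m.player).eval (partyWrite (incoming _ len _ (P r) m) (P r m)) =
          (Q.prog m.player).eval (partyWrite (fun i => (G r).msg T.pattern len 0 i m.player)
            ((G r).proc 0 m.player))
        rw [ih₂ m hm]
        congr 2
        funext j
        unfold incoming
        split
        · rename_i hpeer
          -- Where an honest process has no partner on the path, the Byzantine player stays silent,
          -- matching the empty message there.
          rw [Global.msg, if_pos (T.peer_none m hm j hpeer), hag.silent, List.take_nil]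
          rintro n ⟨-, m', hm', hms'⟩ rfl
          obtain rfl := T.player_inj m' hms' m hm (Node.player_of_peer hm')
          rw [Node.peer_symm hm'] at hpeer
          simp at hpeer
        · rename_i n hpeer
          rw [if_pos (Finset.mem_univ n)]
          by_cases hns : n ∈ T.sim
          · rw [Global.msg, if_pos (T.peer_sim m hm n hns j hpeer), ih₁ n hns,
              ← hag.sends n m.player ⟨hns, m, Node.peer_symm hpeer, hm⟩,
              Node.player_of_peer hpeer]
          · rw [Global.msg, if_neg, ih₂ n hns, Node.player_of_peer hpeer]
            rw [← Node.player_of_peer hpeer]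
            exact T.honest n hns
  exact ((key _ le_rfl).2 m hm).symm

end Run

/-! ## Uniform distributions -/

section Uniform

variable {α β : Type} [Fintype α] [Nonempty α] [Fintype β] [Nonempty β]

theorem uniformOfFintype_map_equiv (e : α ≃ β) :
    (PMF.uniformOfFintype α).map e = PMF.uniformOfFintype β := by
  ext b
  rw [PMF.map_apply, tsum_eq_single (e.symm b)]
  · simp [Fintype.card_congr e]
  · intro a ha
    rw [if_neg]
    rintro rfl
    simp at ha

theorem uniformOfFintype_bind_map_prodMk :
    ((PMF.uniformOfFintype α).bind fun a => (PMF.uniformOfFintype β).map (Prod.mk a)) =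
      PMF.uniformOfFintype (α × β) := by
  ext ⟨a, b⟩
  rw [PMF.bind_apply, tsum_eq_single a]
  · rw [PMF.map_apply, tsum_eq_single b]
    · simp only [PMF.uniformOfFintype_apply, if_true, Fintype.card_prod, Nat.cast_mul]
      rw [ENNReal.mul_inv (by simp) (by simp)]
    · intro b' hb
      rw [if_neg]
      intro h
      exact hb (Prod.mk.inj h).2.symm
  · intro a' ha
    rw [PMF.map_apply, ENNReal.tsum_eq_zero.2, mul_zero]
    intro b'
    rw [if_neg]
    intro h
    exact ha (Prod.mk.inj h).1.symm

theorem uniformOfFintype_map_fst :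
    (PMF.uniformOfFintype (α × β)).map Prod.fst = PMF.uniformOfFintype α := by
  rw [← uniformOfFintype_bind_map_prodMk, PMF.map_bind]
  simp only [PMF.map_comp]
  change ((PMF.uniformOfFintype α).bind fun a => (PMF.uniformOfFintype β).map
    (Function.const β a)) = _
  simp only [PMF.map_const, PMF.bind_pure]

/-- The functions on `κ` split as a product over the range of `e` and its complement, and a marginal
of a uniform product is uniform. -/
theorem uniformOfFintype_map_comp {ι κ V : Type} [Fintype ι] [DecidableEq ι] [Fintype κ]
    [DecidableEq κ] [Fintype V] [Nonempty V] {e : ι → κ} (he : Function.Injective e) :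
    (PMF.uniformOfFintype (κ → V)).map (fun w => w ∘ e) = PMF.uniformOfFintype (ι → V) := by
  classical
  let p : κ → Prop := fun i => i ∈ Set.range e
  rw [← uniformOfFintype_map_equiv
      (((Equiv.ofInjective e he).arrowCongr (Equiv.refl V)).symm : ({i // p i} → V) ≃ (ι → V)),
    ← uniformOfFintype_map_fst (α := {i // p i} → V) (β := {i // ¬ p i} → V),
    ← uniformOfFintype_map_equiv (Equiv.piEquivPiSubtypeProd p fun _ => V), PMF.map_comp,
    PMF.map_comp]
  rfl

end Uniform

/-- The four processes take their bits from four different entries of an independent uniform family.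
The result does not depend on the attack, which is why all three attacks share one path
distribution. -/
theorem Attack.map_assign (T : Attack) (V : Type) [Fintype V] [Nonempty V] :
    (PMF.uniformOfFintype ((Fin 2 → Player → V) × V)).map (fun p => T.assign p.1 p.2) =
      PMF.uniformOfFintype (Node → V) := by
  let e : Node → Option (Fin 2 × Player) := fun n =>
    if n = T.first then some (1, n.player) else if n = T.second then none else some (0, n.player)
  have he : Function.Injective e := by
    intro m n h
    simp only [e] at h
    split_ifs at h with h₁ h₂ h₃ h₄ h₅ h₆ h₇ h₈ <;> simp_all
    exact T.player_inj m (by simp [*]) n (by simp [*]) h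
  let E : (Fin 2 → Player → V) × V ≃ (Option (Fin 2 × Player) → V) :=
    { toFun := fun p o => o.elim p.2 fun i => p.1 i.1 i.2
      invFun := fun w => (fun l i => w (some (l, i)), w none)
      left_inv := fun p => rfl
      right_inv := fun w => by funext o; cases o <;> rfl }
  rw [← uniformOfFintype_map_comp he, ← uniformOfFintype_map_equiv E, PMF.map_comp]
  congr 1
  funext p n
  simp only [Attack.assign, Function.comp_apply, e, E]
  split_ifs <;> rfl

/-! ## The distribution of the outputs -/

/-- The joint distribution of the outputs of the processes of the path. -/
noncomputable def pathOutputs (Q : Protocol Player) (sid : ℕ → Fin 2 → Str) (k : ℕ) :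
    PMF (Node → Str) :=
  (Q.setup k).bind fun τ =>
    (PMF.uniformOfFintype (Node → Fin (Q.coinLen.eval k) → Bool)).map fun w n =>
      fullRun Q k τ (sid k 0) (fun n => List.ofFn (w n)) (Q.rounds.eval k) n .output

theorem bind_congr_of_mem_support {α β : Type} (p : PMF α) {f g : α → PMF β}
    (h : ∀ a ∈ p.support, f a = g a) : p.bind f = p.bind g := by
  ext b
  rw [PMF.bind_apply, PMF.bind_apply]
  refine tsum_congr fun a => ?_
  by_cases ha : a ∈ p.support
  · rw [h a ha]
  · rw [(PMF.apply_eq_zero_iff p a).2 ha, zero_mul, zero_mul]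

theorem Attack.assign_apply (T : Attack) {V W : Type} (c : Fin 2 → Player → V) (a : V) (h : V → W)
    (n : Node) : T.assign (fun l i => h (c l i)) (h a) n = h (T.assign c a n) := by
  unfold Attack.assign
  split_ifs <;> rfl

theorem Attack.real_map (T : Attack) {Q : Protocol Player} {q : Polynomial ℕ}
    (hQ : Q.TimeBound q)
    (hset : ∀ k, ∀ τ ∈ (Q.setup k).support, ∀ i, (τ i).length ≤ Q.setupLen.eval k)
    {sid : ℕ → Fin 2 → Str} (hsid : Q.UniqueSids sid) {x : Fin 2 → Bool}
    (hx : ∀ m ∉ T.sim, m.input = if m.player = .A then [x 0] else [])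
    {β : Type} {f : (Player → Str) → β} {g : (Node → Str) → β}
    (hfg : ∀ o w, (∀ m ∉ T.sim, o m.player = w m) → f o = g w) (k : ℕ) :
    (real Q .A T.pattern (T.machine Q) sid x 0 k).map f = (pathOutputs Q sid k).map g := by
  rw [real, pathOutputs, PMF.map_bind, PMF.map_bind]
  -- The length bound on setup tapes holds only on the support of the setup distribution.
  refine bind_congr_of_mem_support _ fun τ hτ => ?_
  rw [← T.map_assign, ← uniformOfFintype_bind_map_prodMk, PMF.map_bind, PMF.map_comp, PMF.map_bind,
    PMF.map_bind]
  refine congrArg _ (funext fun c => ?_)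
  rw [PMF.map_comp, PMF.map_comp, PMF.map_comp]
  change PMF.map _ (PMF.uniformOfFintype (Fin (Q.coinLen.eval k) → Bool)) = _
  refine congrArg (fun h => PMF.map h _) (funext fun a => ?_)
  refine hfg _ _ fun m hm => ?_
  have hproc := T.proc_eq_fullRun hQ (k := k) (sid := sid k) (x := x) (τ := τ)
    (c := fun l i => List.ofFn (c l i)) (a := List.ofFn a) (hset k τ hτ) ((hsid k).2 0)
    List.length_ofFn (fun _ _ => List.length_ofFn) hx hm
  have hout : ∀ G : Global Player 2, G.outputs T.pattern 0 m.player = G.proc 0 m.player .output :=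
    fun G => if_neg (T.honest m hm)
  have hass : T.assign (fun l i => List.ofFn (c l i)) (List.ofFn a) =
      fun n => List.ofFn (T.assign c a n) := by
    funext n
    exact T.assign_apply c a List.ofFn n
  rw [hass] at hproc
  refine (hout _).trans ?_
  exact congrFun hproc .output

/-- Pointwise, two indicators sum to at most one plus the indicator of the conjunction. -/
theorem map_true_add_map_true_le {α : Type} (p : PMF α) (f g : α → Bool) :
    ((p.map f) true).toReal + ((p.map g) true).toReal ≤
      1 + ((p.map fun a => f a && g a) true).toReal := by
  rw [← ENNReal.toReal_add (PMF.apply_ne_top _ _) (PMF.apply_ne_top _ _), ← ENNReal.toReal_one,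
    ← ENNReal.toReal_add ENNReal.one_ne_top (PMF.apply_ne_top _ _)]
  refine ENNReal.toReal_mono
    (ENNReal.add_ne_top.2 ⟨ENNReal.one_ne_top, PMF.apply_ne_top _ _⟩) ?_
  rw [PMF.map_apply, PMF.map_apply, PMF.map_apply, ← PMF.tsum_coe p, ← ENNReal.tsum_add,
    ← ENNReal.tsum_add]
  refine ENNReal.tsum_le_tsum fun a => ?_
  cases f a <;> cases g a <;> simp

/-! ## Distinguishers -/

/-- Run `p` if the register contains exactly the given bit. -/
def Prog.expect {ρ : Type} (r : ρ) (b : Bool) (p : Prog ρ) : Prog ρ :=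
  if b then .branch r .skip .skip (.seq (.pop r) (.branch r p .skip .skip))
  else .branch r .skip (.seq (.pop r) (.branch r p .skip .skip)) .skip

theorem Prog.eval_expect {ρ : Type} [DecidableEq ρ] {r t : ρ} (h : t ≠ r) (b : Bool) (p : Prog ρ)
    (s : Store ρ) : (Prog.expect r b p).eval s t =
      if s r = [b] then p.eval (Function.update s r []) t else s t := by
  unfold Prog.expect
  rcases hs : s r with _ | ⟨_ | _, _ | ⟨_ | _, l⟩⟩ <;> cases b <;>
    simp [Prog.eval_branch, hs, Function.update_of_ne h]

theorem Prog.time_branch_le {ρ : Type} [DecidableEq ρ] (r : ρ) {p₀ p₁ p₂ : Prog ρ} {n : ℕ}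
    (h₀ : ∀ s, p₀.time s ≤ n) (h₁ : ∀ s, p₁.time s ≤ n) (h₂ : ∀ s, p₂.time s ≤ n) (s : Store ρ) :
    (Prog.branch r p₀ p₁ p₂).time s ≤ n + 1 := by
  rw [Prog.time_branch]
  split
  · exact Nat.add_le_add_right (h₀ s) 1
  · exact Nat.add_le_add_right (h₁ s) 1
  · exact Nat.add_le_add_right (h₂ s) 1

theorem Prog.time_expect_le {ρ : Type} [DecidableEq ρ] (r : ρ) (b : Bool) {p : Prog ρ} {n : ℕ}
    (hp : ∀ s, p.time s ≤ n) (s : Store ρ) : (Prog.expect r b p).time s ≤ n + 4 := by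
  have hskip : ∀ m s, (Prog.skip : Prog ρ).time s ≤ m + 1 := fun m s => Nat.le_add_left 1 m
  have hseq : ∀ s, (Prog.seq (.pop r) (.branch r p .skip .skip)).time s ≤ n + 3 := fun s => by
    have := Prog.time_branch_le r (fun s => Nat.le_succ_of_le (hp s)) (hskip n) (hskip n)
      ((Prog.pop r).eval s)
    rw [Prog.time_seq, Prog.time_pop]
    omega
  unfold Prog.expect
  split_ifs
  · exact Prog.time_branch_le r (hskip _) (hskip _) hseq s
  · exact Prog.time_branch_le r (hskip _) hseq (hskip _) s

theorem acceptProb_eq {D : Machine (DistReg Player)} {f : (Player → Str) → Bool}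
    (h : ∀ k o c, decide (D.prog.eval (distInit k o c) .verdict = [true]) = f o) (k : ℕ)
    (X : PMF (Player → Str)) : acceptProb D k X = ((X.map f) true).toReal := by
  unfold acceptProb
  simp only [h]
  change ENNReal.toReal ((X.bind fun o => PMF.map (Function.const _ (f o)) _) true) = _
  simp only [PMF.map_const]
  rfl

theorem distPolyTime_of_le {D : Machine (DistReg Player)} {n : ℕ} (h : ∀ s, D.prog.time s ≤ n) :
    DistPolyTime D :=
  ⟨Polynomial.C n, fun _ _ _ _ => by simpa using h _⟩

/-- The distinguisher that accepts if the player has output the given bit. -/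
noncomputable def expectOutput (i : Player) (b : Bool) : Machine (DistReg Player) where
  prog := .expect (.sample i) b (.push .verdict true)
  coinLen := 0

theorem expectOutput_verdict (i : Player) (b : Bool) (k : ℕ) (o : Player → Str) (c : Str) :
    decide ((expectOutput i b).prog.eval (distInit k o c) .verdict = [true]) =
      decide (o i = [b]) := by
  refine decide_eq_decide.2 ?_
  simp only [expectOutput]
  rw [Prog.eval_expect (by simp)]
  by_cases h : o i = [b] <;> simp [distInit, h]

theorem expectOutput_polyTime (i : Player) (b : Bool) : DistPolyTime (expectOutput i b) :=
  distPolyTime_of_le fun s => Prog.time_expect_le _ _ (n := 1) (fun _ => le_rfl) s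

/-- The distinguisher that accepts if `B` has output `0` and `C` has output `1`. -/
noncomputable def expectDisagreement : Machine (DistReg Player) where
  prog := .expect (.sample .B) false (.expect (.sample .C) true (.push .verdict true))
  coinLen := 0

theorem expectDisagreement_verdict (k : ℕ) (o : Player → Str) (c : Str) :
    decide (expectDisagreement.prog.eval (distInit k o c) .verdict = [true]) =
      (decide (o .B = [false]) && decide (o .C = [true])) := by
  rw [← Bool.decide_and]
  refine decide_eq_decide.2 ?_
  simp only [expectDisagreement]
  rw [Prog.eval_expect (by simp), Prog.eval_expect (by simp)]
  by_cases h : o .B = [false] <;> by_cases h' : o .C = [true] <;> simp [distInit, h, h']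

theorem expectDisagreement_polyTime : DistPolyTime expectDisagreement :=
  distPolyTime_of_le (Prog.time_expect_le (DistReg.sample Player.B) false (n := 1 + 4)
    (Prog.time_expect_le (DistReg.sample Player.C) true (n := 1) (p := .push DistReg.verdict true)
      fun _ => le_rfl))

/-- The three tested properties are decided by the form of the ideal outputs alone, so the choice of
ideal adversary is immaterial. -/
theorem acceptProb_ideal_of_const {D : Machine (DistReg Player)} {f : (Player → Str) → Bool}
    (h : ∀ k o c, decide (D.prog.eval (distInit k o c) .verdict = [true]) = f o)
    {I : Finset Player} {S : Machine (IdealReg Player 2)} {sid : ℕ → Fin 2 → Str} {v b : Bool}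
    (hb : ∀ s : Store (IdealReg Player 2), f (idealOutputs .A I v s) = b) (k : ℕ) :
    acceptProb D k (ideal .A I S sid v k) = if b then 1 else 0 := by
  rw [acceptProb_eq h, ideal, PMF.map_comp]
  have : (f ∘ fun c : Fin (S.coinLen.eval k) → Bool =>
      idealOutputs .A I v (S.prog.eval (idealInit k (sid k) v (List.ofFn c)))) =
      Function.const _ b := funext fun c => hb _
  rw [this, PMF.map_const, PMF.pure_apply]
  cases b <;> simp

/-! ## The three attacks -/

/-- `A` is corrupt and runs the protocol with input `0` towards `B` and input `1` towards `C`. -/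
def attackA : Attack where
  pattern := ![{.A}, ∅]
  first := .a₀
  second := .a₁
  ne := by decide
  faulty := by decide
  first_notMem := by decide
  honest := by decide
  player_inj := by decide
  peer_sim := by decide
  peer_none := by decide

/-- `C` is corrupt and pretends towards `B` that `A` has input `1`. -/
def attackC : Attack where
  pattern := ![{.C}, {.A}]
  first := .c
  second := .a₁
  ne := by decide
  faulty := by decide
  first_notMem := by decide
  honest := by decide
  player_inj := by decide
  peer_sim := by decide
  peer_none := by decide

/-- `B` is corrupt and pretends towards `C` that `A` has input `0`. -/
def attackB : Attack where
  pattern := ![{.B}, {.A}]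
  first := .b
  second := .a₀
  ne := by decide
  faulty := by decide
  first_notMem := by decide
  honest := by decide
  player_inj := by decide
  peer_sim := by decide
  peer_none := by decide

/-- Against a correct protocol, the path has a property of honest outputs with almost the
probability that it has in the ideal process. -/
theorem Attack.tendsto (T : Attack) {Q : Protocol Player} {sid : ℕ → Fin 2 → Str}
    (hQ : Q.PolyTime) (hsid : Q.UniqueSids sid) (hABG : Q.ParallelABG .A sid basis)
    (hT : T.pattern ∈ basis) (v : Bool)
    (hv : ∀ m ∉ T.sim, m.input = if m.player = .A then [v] else [])
    {D : Machine (DistReg Player)} (hD : DistPolyTime D) {f : (Player → Str) → Bool}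
    (hDf : ∀ k o c, decide (D.prog.eval (distInit k o c) .verdict = [true]) = f o)
    {g : (Node → Str) → Bool}
    (hfg : ∀ o w, (∀ m ∉ T.sim, o m.player = w m) → f o = g w) {b : Bool}
    (hb : ∀ s : Store (IdealReg Player 2), f (idealOutputs .A (T.pattern 0) v s) = b) :
    Filter.Tendsto (fun k => (((pathOutputs Q sid k).map g) true).toReal) Filter.atTop
      (nhds (if b then 1 else 0)) := by
  obtain ⟨hset, q, hq⟩ := hQ
  have hq : Q.TimeBound q := hq
  -- The input of execution `1` is arbitrary, since its messages are never used.
  obtain ⟨S, -, hS⟩ := hABG T.pattern hT (T.machine Q) (T.advPolyTime hq) 0 (fun _ => false)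
  -- Exponent 0 of superpolynomial decay: convergence of the advantage to zero is all that is
  -- needed.
  have h := hS v D hD 0
  simp only [pow_zero, one_mul] at h
  have hx : ∀ m ∉ T.sim, m.input =
      if m.player = .A then [Function.update (fun _ : Fin 2 => false) 0 v 0] else [] := by
    simpa using hv
  have hreal : ∀ k, acceptProb D k (real Q .A T.pattern (T.machine Q) sid
      (Function.update (fun _ : Fin 2 => false) 0 v) 0 k) =
      (((pathOutputs Q sid k).map g) true).toReal := fun k => by
    rw [acceptProb_eq hDf, T.real_map hq hset hsid hx hfg]
  simp only [acceptProb_ideal_of_const hDf hb, hreal] at h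
  rw [tendsto_iff_dist_tendsto_zero]
  simpa only [Real.dist_eq, abs_sub_comm] using h

end ABG

theorem mainTheorem2 :
    ¬ ∃ (Q : ABG.Protocol ABG.Player) (sid : ℕ → Fin 2 → ABG.Str),
      Q.PolyTime ∧ Q.UniqueSids sid ∧ Q.ParallelABG ABG.Player.A sid ABG.basis := by
  rintro ⟨Q, sid, hQ, hsid, hABG⟩
  -- Validity for the honest General `a₀` with input 0.
  open ABG in
  have hB := attackC.tendsto hQ hsid hABG (by simp [basis, attackC]) false
    (by decide) (expectOutput_polyTime .B false) (expectOutput_verdict .B false)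
    (g := fun w => decide (w .b = [false]))
    (fun o w h => by rw [← h .b (by decide)]; rfl) (b := true)
    (fun s => by simp [attackC, idealOutputs])
  -- Validity for the honest General `a₁` with input 1.
  open ABG in
  have hC := attackB.tendsto hQ hsid hABG (by simp [basis, attackB]) true
    (by decide) (expectOutput_polyTime .C true) (expectOutput_verdict .C true)
    (g := fun w => decide (w .c = [true]))
    (fun o w h => by rw [← h .c (by decide)]; rfl) (b := true)
    (fun s => by simp [attackB, idealOutputs])
  -- Agreement: both honest outputs equal the single value sent to the trusted party, so they cannot
  -- be 0 and 1. The General's nominal input plays no role, as he is Byzantine.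
  open ABG in
  have hA := attackA.tendsto hQ hsid hABG (by simp [basis, attackA]) false
    (by decide) expectDisagreement_polyTime expectDisagreement_verdict
    (g := fun w => decide (w .b = [false]) && decide (w .c = [true]))
    (fun o w h => by rw [← h .b (by decide), ← h .c (by decide)]; rfl) (b := false)
    (fun s => by
      by_cases h : s .toTTP = [false] <;> simp [attackA, idealOutputs, h])
  -- In the limit the inequality reads 1 + 1 ≤ 1 + 0.
  have h := le_of_tendsto_of_tendsto' (hB.add hC) (tendsto_const_nhds.add hA)
    fun k => ABG.map_true_add_map_true_le (ABG.pathOutputs Q sid k) _ _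
  norm_num at h
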